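/- Let $2\le r<m$ and $p\ge 0$ be integers, let $M^r$ be an $r$-dimensional smooth manifold, and let $\mathbb{R}^{r+p}_+=\{x\in\mathbb{R}^{r+p}: x_{r+p}>0\}$ carry the hyperbolic metric $x_{r+p}^{-2}\sum_{i=1}^{r+p}dx_i^2$ of constant curvature $-1$. Let $u=(x_1,\dots,x_{r+p}):M^r\to\mathbb{R}^{r+p}_+$ be a smooth immersion, and let the rotational submanifold over $u$ be $$f:M^r\times\mathbb{S}^{m-r}\to\mathbb{R}^{m+p},\qquad f(x,\varphi)=(x_1(x),\dots,x_{r+p-1}(x),x_{r+p}(x)\,\varphi),$$ where $\mathbb{S}^{m-r}$ is the unit sphere of $\mathbb{R}^{m-r+1}$. For $k\ge 2$, a $k$-dimensional immersed submanifold of codimension $p$ in a Riemannian manifold of constant curvature $c$, with the induced metric, is called *Wintgen ideal* if at every point equality holds in the DDVV inequality $$s\le c+\|H\|^2-s^\perp .$$ Here $H$ is the mean curvature vector (the trace of the second fundamental form divided by $k$), $s=\frac{2}{k(k-1)}\sum_{i<j}\langle R(e_i,e_j)e_j,e_i\rangle$ and $s^\perp=\frac{2}{k(k-1)}\|R^\perp\|$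 with $\|R^\perp\|^2=\sum_{i<j}\sum_{\alpha<\beta}\langle R^\perp(e_i,e_j)n_\alpha,n_\beta\rangle^2$, where $R$ is the Riemann curvature tensor of the induced metric, $R^\perp$ is the curvature tensor of the normal connection, and $(e_i)$, $(n_\alpha)$ are orthonormal bases of the tangent and the normal space. It is called *minimal* if $H=0$ at every point. Then $f$ is a Wintgen ideal submanifold of the Euclidean space $\mathbb{R}^{m+p}$ ($c=0$) if and only if $u$ is a minimal Wintgen ideal submanifold of the hyperbolic space $\mathbb{R}^{r+p}_+$ ($c=-1$). -/

import Mathlib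

open scoped Manifold ContDiff

noncomputable section

namespace Wintgen

/-! ### Riemannian metrics in coordinates, Levi-Civita connection, curvature -/

section Coordinates

variable {E : Type*} [NormedAddCommGroup E] [NormedSpace ℝ E]

/-- A field of bilinear forms on (an open part of) a real normed space `E`; a Riemannian metric in
coordinates is such a field whose values are symmetric and positive definite. -/
abbrev MetricField (E : Type*) [NormedAddCommGroup E] [NormedSpace ℝ E] :=
  E → E →L[ℝ] E →L[ℝ] ℝ

/-- The Christoffel symbol `Γ_y(v, w)` of the Levi-Civita connection of `g`, i.e. the covariant
derivative at `y` of the constant field `w` in the direction `v`. It is the vector determined by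
`2 g_y(Γ_y(v, w), z) = (∂_v g)(w, z) + (∂_w g)(v, z) - (∂_z g)(v, w)` for all `z`. Here
`(g y).inverse` is the inverse of the isomorphism `E → E*` given by the nondegenerate form `g y`. -/
def christoffel (g : MetricField E) (y v w : E) : E :=
  (1 / 2 : ℝ) • (g y).inverse
    (fderiv ℝ g y v w + fderiv ℝ g y w v - ((fderiv ℝ g y).flip v).flip w)

/-- The Riemann curvature tensor of `g` at `y`:
`R(X, Y) Z = ∇_X ∇_Y Z - ∇_Y ∇_X Z` for the constant (coordinate) fields `X`, `Y`, `Z`. -/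
def riemannCurvature (g : MetricField E) (y X Y Z : E) : E :=
  (fderiv ℝ (fun q => christoffel g q Y Z) y X + christoffel g y X (christoffel g y Y Z))
    - (fderiv ℝ (fun q => christoffel g q X Z) y Y + christoffel g y Y (christoffel g y X Z))

/-- `e` is an orthonormal family for the bilinear form `b`. -/
def IsOrthonormalFamily {k : ℕ} (b : E →L[ℝ] E →L[ℝ] ℝ) (e : Fin k → E) : Prop :=
  ∀ i j, b (e i) (e j) = if i = j then 1 else 0

end Coordinates

/-! ### Geometry of a parametrized submanifold `F` of a space `V` with metric `G` -/

section Local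

variable {E : Type*} [NormedAddCommGroup E] [NormedSpace ℝ E]
variable {V : Type*} [NormedAddCommGroup V] [NormedSpace ℝ V]

/-- The induced metric (first fundamental form) `F^* G`. -/
def inducedMetric (G : MetricField V) (F : E → V) : MetricField E :=
  fun q => (G (F q)).bilinearComp (fderiv ℝ F q) (fderiv ℝ F q)

/-- The orthogonal projection of `w` to the normal space of `F` at `q`. The tangential part of `w`
is `dF_q(t)`, where `t` is the vector with `(F^* G)(t, v) = G(w, dF_q(v))` for all `v`. -/
def normalProj (G : MetricField V) (F : E → V) (q : E) (w : V) : V :=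
  w - fderiv ℝ F q ((inducedMetric G F q).inverse ((G (F q) w).comp (fderiv ℝ F q)))

/-- The covariant derivative at `q`, in the direction `X` and for the Levi-Civita connection of the
ambient metric `G`, of a vector field `ξ` of the ambient space along `F`. -/
def ambientDeriv (G : MetricField V) (F : E → V) (X : E) (ξ : E → V) (q : E) : V :=
  fderiv ℝ ξ q X + christoffel G (F q) (fderiv ℝ F q X) (ξ q)

/-- The second fundamental form `II(X, Y)`: the normal part of the ambient covariant derivative
of `dF(Y)` in the direction `X`. -/
def secondFundamentalForm (G : MetricField V) (F : E → V) (q X Y : E) : V :=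
  normalProj G F q (ambientDeriv G F X (fun q' => fderiv ℝ F q' Y) q)

/-- The normal connection: the normal part of the ambient covariant derivative. -/
def normalDeriv (G : MetricField V) (F : E → V) (X : E) (ξ : E → V) (q : E) : V :=
  normalProj G F q (ambientDeriv G F X ξ q)

/-- The normal curvature tensor at `q`:
`R^⊥(X, Y) n = ∇^⊥_X ∇^⊥_Y ξ - ∇^⊥_Y ∇^⊥_X ξ` for the constant (coordinate) fields `X`, `Y` and
the normal field `ξ` that extends the normal vector `n` by orthogonal projection. -/
def normalCurvature (G : MetricField V) (F : E → V) (q X Y : E) (n : V) : V :=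
  normalDeriv G F X (normalDeriv G F Y fun q' => normalProj G F q' n) q
    - normalDeriv G F Y (normalDeriv G F X fun q' => normalProj G F q' n) q

/-- `n` is an orthonormal family of normal vectors of `F` at `q`. -/
def IsNormalFrame {p : ℕ} (G : MetricField V) (F : E → V) (q : E) (n : Fin p → V) : Prop :=
  IsOrthonormalFamily (G (F q)) n ∧ ∀ a v, G (F q) (n a) (fderiv ℝ F q v) = 0

/-- The normalized scalar curvature
`s = 2 / (m (m - 1)) * ∑_{i < j} ⟨R(e_i, e_j) e_j, e_i⟩` of the metric `g`, computed in the
orthonormal basis `e` of the tangent space. -/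
def scalarCurvature {m : ℕ} (g : MetricField E) (q : E) (e : Fin m → E) : ℝ :=
  2 / ((m : ℝ) * ((m : ℝ) - 1)) *
    ∑ i, ∑ j ∈ Finset.Ioi i, g q (riemannCurvature g q (e i) (e j) (e j)) (e i)

/-- The mean curvature vector `H = (1 / m) * ∑_j II(e_j, e_j)`. -/
def meanCurvature {m : ℕ} (G : MetricField V) (F : E → V) (q : E) (e : Fin m → E) : V :=
  (1 / (m : ℝ)) • ∑ j, secondFundamentalForm G F q (e j) (e j)

/-- The normal scalar curvature `s^⊥ = 2 / (m (m - 1)) * ‖R^⊥‖`, where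
`‖R^⊥‖² = ∑_{i < j} ∑_{a < b} ⟨R^⊥(e_i, e_j) n_a, n_b⟩²`
(the normalization for which the DDVV inequality is valid and sharp). -/
def normalScalarCurvature {m p : ℕ} (G : MetricField V) (F : E → V) (q : E)
    (e : Fin m → E) (n : Fin p → V) : ℝ :=
  2 / ((m : ℝ) * ((m : ℝ) - 1)) *
    √(∑ i, ∑ j ∈ Finset.Ioi i, ∑ a, ∑ b ∈ Finset.Ioi a,
      (G (F q) (normalCurvature G F q (e i) (e j) (n a)) (n b)) ^ 2)

/-- Equality in the DDVV inequality `s ≤ c + ‖H‖² - s^⊥` at `q`, for an `m`-dimensional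
submanifold of codimension `p`. The quantities involved do not depend on the orthonormal bases
of the tangent space and of the normal space. -/
def DDVVEquality (G : MetricField V) (c : ℝ) (m p : ℕ) (F : E → V) (q : E) : Prop :=
  ∀ (e : Fin m → E) (n : Fin p → V),
    IsOrthonormalFamily (inducedMetric G F q) e → IsNormalFrame G F q n →
      scalarCurvature (inducedMetric G F) q e =
        c + G (F q) (meanCurvature G F q e) (meanCurvature G F q e)
          - normalScalarCurvature G F q e n

/-- The mean curvature vector of the `m`-dimensional submanifold `F` vanishes at `q`. -/
def MeanCurvatureVanishes (G : MetricField V) (m : ℕ) (F : E → V) (q : E) : Prop :=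
  ∀ e : Fin m → E, IsOrthonormalFamily (inducedMetric G F q) e → meanCurvature G F q e = 0

end Local

/-! ### Immersed submanifolds -/

section Global

variable {E : Type*} [NormedAddCommGroup E] [NormedSpace ℝ E]
variable {H : Type*} [TopologicalSpace H] (I : ModelWithCorners ℝ E H)
variable {N : Type*} [TopologicalSpace N] [ChartedSpace H N]
variable {V : Type*} [NormedAddCommGroup V] [NormedSpace ℝ V]

/-- A smooth immersion of a manifold into a finite-dimensional vector space: a smooth map with
injective differential everywhere. -/
def IsSmoothImmersion (f : N → V) : Prop :=
  ContMDiff I 𝓘(ℝ, V) ∞ f ∧ ∀ x, Function.Injective (mfderiv I 𝓘(ℝ, V) f x)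

/-- The local parametrization of the submanifold `f` by the preferred chart at `x`. -/
def localParam (f : N → V) (x : N) : E → V := f ∘ (extChartAt I x).symm

/-- The `m`-dimensional submanifold `f` of codimension `p`, in an open part of `V` with a metric `G`
of constant curvature `c`, is Wintgen ideal: `f` is an immersion, and equality holds in the DDVV
inequality at every point. -/
def IsWintgenIdeal (G : MetricField V) (c : ℝ) (m p : ℕ) (f : N → V) : Prop :=
  IsSmoothImmersion I f ∧
    ∀ x, DDVVEquality G c m p (localParam I f x) (extChartAt I x x)

/-- The `m`-dimensional submanifold `f` in an open part of `V` with metric `G` is minimal: `f` is an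
immersion, and its mean curvature vector vanishes at every point. -/
def IsMinimal (G : MetricField V) (m : ℕ) (f : N → V) : Prop :=
  IsSmoothImmersion I f ∧
    ∀ x, MeanCurvatureVanishes G m (localParam I f x) (extChartAt I x x)

end Global

/-! ### Euclidean space, the half-space model and the rotational submanifold -/

/-- The flat metric of `ℝ^n`. -/
def euclideanMetric (n : ℕ) : MetricField (EuclideanSpace ℝ (Fin n)) :=
  fun _ => innerSL ℝ

/-- The (0-based) index of the last coordinate of `ℝ^n`. -/
def lastIndex (n : ℕ) (hn : 0 < n) : Fin n := ⟨n - 1, Nat.sub_lt hn Nat.one_pos⟩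

/-- The upper half-space `x_n > 0` in `ℝ^n`. -/
def upperHalfSpace (n : ℕ) (hn : 0 < n) : Set (EuclideanSpace ℝ (Fin n)) :=
  {y | 0 < y (lastIndex n hn)}

/-- The hyperbolic metric `x_n⁻² ∑ dx_i²` (relevant on the upper half-space only). -/
def hyperbolicMetric (n : ℕ) (hn : 0 < n) : MetricField (EuclideanSpace ℝ (Fin n)) :=
  fun y => ((y (lastIndex n hn)) ^ 2)⁻¹ • innerSL ℝ

/-- The rotational submanifold over `u = (x_1, …, x_{r+p})`:
`f(x, φ) = (x_1, …, x_{r+p-1}, x_{r+p} φ)`, with `φ` in the unit sphere of `ℝ^{m-r+1}`. -/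
def rotational {M : Type*} {r p m : ℕ} (hr : 0 < r + p) (hrm : r < m)
    (u : M → EuclideanSpace ℝ (Fin (r + p)))
    (z : M × Metric.sphere (0 : EuclideanSpace ℝ (Fin (m - r + 1))) 1) :
    EuclideanSpace ℝ (Fin (m + p)) :=
  WithLp.toLp 2 fun i =>
    if h : (i : ℕ) < r + p - 1 then u z.1 ⟨i, by omega⟩
    else u z.1 (lastIndex (r + p) hr) *
      (z.2 : EuclideanSpace ℝ (Fin (m - r + 1))) ⟨i - (r + p - 1), by omega⟩

end Wintgen

end

/-! By the Gauss and Ricci equations, equality in the DDVV inequality at a point is a condition on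
the matrices `A a` of the shape operators in orthonormal frames, `∑ (‖A a‖² - (tr A a)² / m) = √(∑
‖⁅A a, A b⁆‖²)`, with Frobenius norms; the ambient curvature cancels (`ddvv_equality_iff`). This
condition is unchanged by orthogonal conjugation and by adding a multiple of the identity to each `A
a`.

Let `x` be the last coordinate of `u`. The metric induced by `f` is `du² + x² dφ²`, which is `x²`
times the product of the hyperbolic metric of `u` and the round metric. Scale orthonormal frames of
the two factors by `x⁻¹` and lift the normal vectors of `u` to normal vectors of `f`. The shape
matrices of `f` then become `x⁻¹ A a ⊕ 0` plus a multiple of the identity, where the `A a` are the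
hyperbolic shape matrices of `u` (`shapeMatrix_rotMap`): the conformal correction along `M` and the
bending of the sphere directions give the same scalar.

Hence `f` attains equality exactly if `S - T / m = √L`, where `S = ∑ ‖A a‖²`, `T = ∑ (tr A a)²` and
`L = ∑ ‖⁅A a, A b⁆‖²`. The DDVV inequality for `u` says `√L ≤ S - T / r`. As `r < m`, equality for
`f` forces `T = 0`, which is minimality, and then equality for `u`; the converse is immediate
(`wintgenEq_fromBlocks_iff`).

What remains is the algebraic inequality `lieSum_le_normSum_sq`. Take a family of total norm one
that maximizes `L`. Varying it along `A a + t v a C` with `C = ∑ v a A a` gives `∑ ‖⁅C, A b⁆‖² = L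
‖C‖²`. If the unit vector `v` maximizes `‖C‖`, then `C` is a top eigenvector of `X ↦ ∑ ⟨A a, X⟩ A
a`; after diagonalizing `C`, a bound for a weighted graph Laplacian yields `∑ ‖⁅C, A b⁆‖² ≤ ‖C‖²`,
so `L ≤ 1`. -/

open scoped Topology

namespace Wintgen

/-! ### Symmetric matrices and their commutators -/

section Algebra

open Matrix

attribute [local instance] LieRing.ofAssociativeRing LieAlgebra.ofAssociativeAlgebra

/-- A weighted edge-Laplacian bound for vectors of squared length two and small mutual products. -/
lemma sum_mul_inner_sq_le {ι F : Type*} [NormedAddCommGroup F] [InnerProductSpace ℝ F]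
    (s : Finset ι) (N : ι → F) (h2 : ∀ e ∈ s, inner ℝ (N e) (N e) = 2)
    (h1 : ∀ e ∈ s, ∀ f ∈ s, e ≠ f → |inner ℝ (N e) (N f)| ≤ 1) (r : ι → ℝ) (R : ℝ)
    (hR : 0 ≤ R) (h0 : ∀ e ∈ s, 0 ≤ r e) (hr : ∀ e ∈ s, r e ≤ R) (x : F) :
    ∑ e ∈ s, r e * inner ℝ x (N e) ^ 2 ≤ (∑ e ∈ s, r e + R) * inner ℝ x x := by
  classical
  set y : ι → ℝ := fun e => inner ℝ x (N e) with hy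
  set z : F := ∑ e ∈ s, (r e * y e) • N e with hz
  set S := ∑ e ∈ s, r e * y e ^ 2 with hS
  set W := ∑ e ∈ s, r e with hW
  have hS0 : 0 ≤ S := Finset.sum_nonneg fun e he => mul_nonneg (h0 e he) (sq_nonneg _)
  have hW0 : 0 ≤ W := Finset.sum_nonneg h0
  have hxz : inner ℝ x z = S := by
    simp only [hz, inner_sum, inner_smul_right, hS]
    exact Finset.sum_congr rfl fun e _ => by simp only [hy]; ring
  have hxx : (0 : ℝ) ≤ inner ℝ x x := real_inner_self_nonneg
  have hzz : inner ℝ z z ≤ (W + R) * S := by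
    have e1 : inner ℝ z z
        = ∑ e ∈ s, ∑ f ∈ s, r e * y e * (r f * y f) * inner ℝ (N e) (N f) := by
      simp only [hz, sum_inner, inner_sum, inner_smul_left, inner_smul_right]
      refine Finset.sum_congr rfl fun e _ => ?_
      rw [Finset.mul_sum]
      refine Finset.sum_congr rfl fun f _ => ?_
      rw [real_inner_comm (N e) (N f), RCLike.conj_to_real]
      ring
    -- Off the diagonal this is the inequality of the means. On the diagonal the Gram entry `2`
    -- leaves an excess `r e ^ 2 * y e ^ 2`, which `r e ≤ R` bounds by the extra term.
    have e2 : ∀ e ∈ s, ∀ f ∈ s, r e * y e * (r f * y f) * inner ℝ (N e) (N f)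
        ≤ r e * r f * (y e ^ 2 + y f ^ 2) / 2 + if e = f then R * (r e * y e ^ 2) else 0 := by
      intro e he f hf
      have he0 := h0 e he
      have hf0 := h0 f hf
      split_ifs with h
      · subst h
        rw [h2 e he]
        nlinarith [mul_nonneg (mul_nonneg he0 (sq_nonneg (y e))) (sub_nonneg.2 (hr e he))]
      · have hk := abs_le.1 (h1 e he f hf h)
        have : y e * y f * inner ℝ (N e) (N f) ≤ (y e ^ 2 + y f ^ 2) / 2 := by
          have ha : y e * y f * inner ℝ (N e) (N f) ≤ |y e| * |y f| * 1 := by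
            refine (le_abs_self _).trans ?_
            rw [abs_mul, abs_mul]
            exact mul_le_mul_of_nonneg_left (h1 e he f hf h) (by positivity)
          have := two_mul_le_add_sq |y e| |y f|
          rw [sq_abs, sq_abs] at this
          linarith
        nlinarith [mul_le_mul_of_nonneg_left this (mul_nonneg he0 hf0)]
    rw [e1]
    refine (Finset.sum_le_sum fun e he => Finset.sum_le_sum fun f hf => e2 e he f hf).trans
      (le_of_eq ?_)
    simp only [Finset.sum_add_distrib]
    have e3 : ∑ e ∈ s, ∑ f ∈ s, r e * r f * (y e ^ 2 + y f ^ 2) / 2 = W * S := by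
      have a1 : W * S = ∑ e ∈ s, ∑ f ∈ s, r e * (r f * y f ^ 2) := by
        rw [hW, hS, Finset.sum_mul_sum]
      have a2 : W * S = ∑ e ∈ s, ∑ f ∈ s, r f * (r e * y e ^ 2) := by
        rw [a1, Finset.sum_comm]
      have a3 : W * S = (W * S + W * S) / 2 := by ring
      rw [a3]
      nth_rewrite 1 [a1]
      rw [a2, ← Finset.sum_add_distrib, Finset.sum_div]
      refine Finset.sum_congr rfl fun e _ => ?_
      rw [← Finset.sum_add_distrib, Finset.sum_div]
      exact Finset.sum_congr rfl fun f _ => by ring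
    rw [e3]
    have e4 : ∑ e ∈ s, ∑ f ∈ s, (if e = f then R * (r e * y e ^ 2) else 0) = R * S := by
      rw [hS, Finset.mul_sum]
      exact Finset.sum_congr rfl fun e he => by simp [he]
    rw [e4]; ring
  -- Cauchy–Schwarz gives `S ^ 2 ≤ ⟪x, x⟫ * (W + R) * S`, from which a factor `S` is cancelled
  -- unless it vanishes.
  have hcs := real_inner_mul_inner_self_le x z
  rw [hxz] at hcs
  rcases hS0.eq_or_lt with h | h
  · rw [← h]
    exact mul_nonneg (by linarith) hxx
  · have := hcs.trans (mul_le_mul_of_nonneg_left hzz hxx)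
    nlinarith

lemma sum_sum_eq_of_symm {m : ℕ} (g : Fin m → Fin m → ℝ) (hg : ∀ i j, g i j = g j i) :
    ∑ i, ∑ j, g i j = ∑ i, g i i + 2 * ∑ i, ∑ j ∈ Finset.Ioi i, g i j := by
  have h : ∀ i j : Fin m, g i j = (if i = j then g i i else 0) +
      ((if i < j then g i j else 0) + if j < i then g i j else 0) := by
    intro i j
    rcases lt_trichotomy i j with h | h | h
    · simp [h, h.ne, h.not_gt]
    · simp [h]
    · simp [h, h.ne', h.not_gt]
  have e1 : ∀ i : Fin m, ∑ j ∈ Finset.Ioi i, g i j = ∑ j, if i < j then g i j else 0 := by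
    intro i
    rw [← Finset.sum_filter]
    congr 1
    ext j; simp
  have e2 : ∑ i, ∑ j, (if j < i then g i j else 0) = ∑ i, ∑ j, if i < j then g i j else 0 := by
    rw [Finset.sum_comm]
    exact Finset.sum_congr rfl fun i _ => Finset.sum_congr rfl fun j _ => by rw [hg]
  calc ∑ i, ∑ j, g i j = ∑ i, ∑ j, ((if i = j then g i i else 0) +
      ((if i < j then g i j else 0) + if j < i then g i j else 0)) :=
        Finset.sum_congr rfl fun i _ => Finset.sum_congr rfl fun j _ => h i j
    _ = _ := by
      simp only [Finset.sum_add_distrib, e2, e1]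
      simp only [Finset.sum_ite_eq, Finset.mem_univ, if_true]
      ring

/-- The Frobenius inner product. -/
def frob {n : Type*} [Fintype n] (X Y : Matrix n n ℝ) : ℝ := trace (Xᵀ * Y)

/-! ### The Frobenius inner product -/

section Frob

variable {n : Type*} [Fintype n]

lemma frob_eq_sum (X Y : Matrix n n ℝ) : frob X Y = ∑ i, ∑ j, X i j * Y i j := by
  rw [frob, trace, Finset.sum_comm]
  rfl

lemma frob_comm (X Y : Matrix n n ℝ) : frob X Y = frob Y X := by
  simp [frob_eq_sum, mul_comm]

lemma frob_add_left (X Y Z : Matrix n n ℝ) : frob (X + Y) Z = frob X Z + frob Y Z := by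
  simp [frob, Matrix.add_mul]

lemma frob_add_right (X Y Z : Matrix n n ℝ) : frob X (Y + Z) = frob X Y + frob X Z := by
  simp [frob, Matrix.mul_add]

lemma frob_smul_left (c : ℝ) (X Y : Matrix n n ℝ) : frob (c • X) Y = c * frob X Y := by
  simp [frob]

lemma frob_smul_right (c : ℝ) (X Y : Matrix n n ℝ) : frob X (c • Y) = c * frob X Y := by
  simp [frob]

lemma frob_sum_left {ι : Type*} (s : Finset ι) (X : ι → Matrix n n ℝ) (Y : Matrix n n ℝ) :
    frob (∑ a ∈ s, X a) Y = ∑ a ∈ s, frob (X a) Y := by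
  simp [frob, Matrix.transpose_sum, Matrix.sum_mul, Matrix.trace_sum]

lemma frob_neg_neg (X Y : Matrix n n ℝ) : frob (-X) (-Y) = frob X Y := by
  simp [frob]

lemma frob_self_nonneg (X : Matrix n n ℝ) : 0 ≤ frob X X := by
  rw [frob_eq_sum]
  exact Finset.sum_nonneg fun i _ => Finset.sum_nonneg fun j _ => mul_self_nonneg _

lemma frob_self_eq_zero {X : Matrix n n ℝ} (h : frob X X = 0) : X = 0 := by
  have hs : ∀ i, 0 ≤ ∑ j, X i j * X i j := fun i =>
    Finset.sum_nonneg fun j _ => mul_self_nonneg _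
  rw [frob_eq_sum] at h
  ext i j
  have h1 := (Finset.sum_eq_zero_iff_of_nonneg fun i _ => hs i).1 h i (Finset.mem_univ _)
  have h2 := (Finset.sum_eq_zero_iff_of_nonneg
    fun j _ => mul_self_nonneg (X i j)).1 h1 j (Finset.mem_univ _)
  exact mul_self_eq_zero.1 h2

lemma frob_sq_le (X Y : Matrix n n ℝ) : frob X Y ^ 2 ≤ frob X X * frob Y Y := by
  have h := Finset.sum_mul_sq_le_sq_mul_sq (Finset.univ : Finset (n × n))
    (fun e => X e.1 e.2) (fun e => Y e.1 e.2)
  simpa [frob_eq_sum, Fintype.sum_prod_type, sq] using h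

variable [DecidableEq n]

lemma frob_conj {U : Matrix n n ℝ} (hU : U * Uᵀ = 1) (X Y : Matrix n n ℝ) :
    frob (Uᵀ * X * U) (Uᵀ * Y * U) = frob X Y := by
  have : (Uᵀ * X * U)ᵀ * (Uᵀ * Y * U) = Uᵀ * (Xᵀ * (U * Uᵀ) * Y * U) := by
    simp [Matrix.mul_assoc]
  rw [frob, this, trace_mul_comm, hU]
  simp [frob, Matrix.mul_assoc, hU]

lemma lie_conj {U : Matrix n n ℝ} (hU : U * Uᵀ = 1) (X Y : Matrix n n ℝ) :
    ⁅Uᵀ * X * U, Uᵀ * Y * U⁆ = Uᵀ * ⁅X, Y⁆ * U := by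
  have h : ∀ X Y : Matrix n n ℝ, (Uᵀ * X * U) * (Uᵀ * Y * U) = Uᵀ * (X * Y) * U := by
    intro X Y
    calc (Uᵀ * X * U) * (Uᵀ * Y * U) = Uᵀ * (X * (U * Uᵀ) * Y) * U := by
          simp [Matrix.mul_assoc]
      _ = _ := by rw [hU, Matrix.mul_one]
  simp only [Ring.lie_def, h, Matrix.mul_sub, Matrix.sub_mul]

end Frob

/-! ### Commutators with an extremal symmetric matrix -/

lemma lie_diagonal_apply {m : ℕ} (d : Fin m → ℝ) (X : Matrix (Fin m) (Fin m) ℝ) (i j : Fin m) :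
    ⁅diagonal d, X⁆ i j = (d i - d j) * X i j := by
  simp [Ring.lie_def]
  ring

/-- In the eigenbasis, `⁅diagonal d, A a⁆ i j = (d i - d j) * A a i j`, so the left side is the
Laplacian form of the complete graph with edge weights `2 * q i j`, where `q i j = ∑ a, A a i j ^
2`. The hypotheses say that `diagonal d` attains the maximum `lam` of `∑ a, ⟨A a, X⟩² / ‖X‖²` over
symmetric `X` (if `d ≠ 0`). Maximality bounds each edge weight by `lam`, and attainment bounds `lam`
by the diagonal mass `∑ i, q i i`, which pays for the extra term `R = lam` of the Laplacian bound.
-/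
lemma sum_frob_lie_diagonal_le {ι : Type*} [Fintype ι] {m : ℕ} (d : Fin m → ℝ)
    (A : ι → Matrix (Fin m) (Fin m) ℝ) (hA : ∀ a, (A a).IsSymm) (lam : ℝ) (hlam : 0 ≤ lam)
    (h1 : ∀ X : Matrix (Fin m) (Fin m) ℝ, X.IsSymm → ∑ a, frob (A a) X ^ 2 ≤ lam * frob X X)
    (h2 : lam * frob (diagonal d) (diagonal d) ≤ ∑ a, frob (A a) (diagonal d) ^ 2) :
    ∑ a, frob ⁅diagonal d, A a⁆ ⁅diagonal d, A a⁆
      ≤ frob (diagonal d) (diagonal d) * ∑ a, frob (A a) (A a) := by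
  have hdd : frob (diagonal d) (diagonal d) = ∑ i, d i ^ 2 := by
    rw [frob_eq_sum]
    refine Finset.sum_congr rfl fun i _ => ?_
    rw [Finset.sum_eq_single i] <;> simp +contextual [sq, eq_comm]
  have hAd : ∀ a, frob (A a) (diagonal d) = ∑ i, A a i i * d i := by
    intro a
    rw [frob_eq_sum]
    refine Finset.sum_congr rfl fun i _ => ?_
    rw [Finset.sum_eq_single i] <;> simp +contextual [eq_comm]
  rcases (frob_self_nonneg (diagonal d)).eq_or_lt with h0 | hpos
  · simp only [frob_self_eq_zero h0.symm, zero_lie, frob_eq_sum, Matrix.zero_apply, mul_zero,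
      Finset.sum_const_zero, zero_mul, le_refl]
  set q : Fin m → Fin m → ℝ := fun i j => ∑ a, A a i j ^ 2 with hq
  have hqs : ∀ i j, q i j = q j i := fun i j =>
    Finset.sum_congr rfl fun a _ => by rw [(hA a).apply]
  have s1 : ∑ a, frob ⁅diagonal d, A a⁆ ⁅diagonal d, A a⁆
      = ∑ i, ∑ j ∈ Finset.Ioi i, 2 * q i j * (d i - d j) ^ 2 := by
    have : ∑ a, frob ⁅diagonal d, A a⁆ ⁅diagonal d, A a⁆
        = ∑ i, ∑ j, (d i - d j) ^ 2 * q i j := by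
      simp only [frob_eq_sum, lie_diagonal_apply, hq, Finset.mul_sum]
      rw [Finset.sum_comm]
      refine Finset.sum_congr rfl fun i _ => ?_
      rw [Finset.sum_comm]
      exact Finset.sum_congr rfl fun j _ => Finset.sum_congr rfl fun a _ => by ring
    rw [this, sum_sum_eq_of_symm _ fun i j => by rw [hqs i j]; ring]
    simp only [sub_self, Finset.mul_sum]
    simp only [ne_eq, OfNat.ofNat_ne_zero, not_false_eq_true, zero_pow, zero_mul,
      Finset.sum_const_zero, zero_add]
    exact Finset.sum_congr rfl fun i _ => Finset.sum_congr rfl fun j _ => by ring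
  have s2 : ∑ a, frob (A a) (A a) = ∑ i, q i i + ∑ i, ∑ j ∈ Finset.Ioi i, 2 * q i j := by
    have : ∑ a, frob (A a) (A a) = ∑ i, ∑ j, q i j := by
      simp only [frob_eq_sum, hq]
      rw [Finset.sum_comm]
      refine Finset.sum_congr rfl fun i _ => ?_
      rw [Finset.sum_comm]
      exact Finset.sum_congr rfl fun j _ => Finset.sum_congr rfl fun a _ => by ring
    rw [this, sum_sum_eq_of_symm _ hqs]
    simp only [Finset.mul_sum]
  -- Pairing with `diagonal d` sees only the diagonal entries of `A a`, so Cauchy–Schwarz turns `h2`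
  -- into this bound.
  have s3 : lam ≤ ∑ i, q i i := by
    have : ∑ a, frob (A a) (diagonal d) ^ 2 ≤ (∑ i, q i i) * ∑ i, d i ^ 2 := by
      simp only [hq, hAd]
      rw [Finset.sum_comm, Finset.sum_mul]
      exact Finset.sum_le_sum fun a _ => Finset.sum_mul_sq_le_sq_mul_sq _ _ _
    rw [hdd] at h2 hpos
    exact le_of_mul_le_mul_right (h2.trans this) hpos
  set s : Finset (Σ _ : Fin m, Fin m) := Finset.univ.sigma fun i => Finset.Ioi i with hs
  have hmem : ∀ e ∈ s, e.1 < e.2 := fun e he => by simpa [hs] using he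
  -- The test matrix `E_ij + E_ji` has squared norm `2`, and its pairing with `A a` is `2 * A a i
  -- j`.
  have hqle : ∀ e ∈ s, 2 * q e.1 e.2 ≤ lam := by
    intro e he
    have hne := (hmem e he).ne
    have h := h1 (single e.1 e.2 1 + single e.2 e.1 1) (by
      rw [IsSymm, transpose_add, transpose_single, transpose_single, add_comm])
    have f1 : ∀ X : Matrix (Fin m) (Fin m) ℝ, ∀ i j, frob X (single i j 1) = X i j := by
      intro X i j
      rw [frob, trace_mul_single]
      simp
    simp only [frob_add_right, f1, Matrix.add_apply, single_apply, hne, hne.symm] at h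
    have : ∑ a, (A a e.1 e.2 + A a e.2 e.1) ^ 2 = 2 * (2 * q e.1 e.2) := by
      simp only [hq, Finset.mul_sum]
      exact Finset.sum_congr rfl fun a _ => by rw [(hA a).apply e.1 e.2]; ring
    rw [this] at h
    norm_num at h
    linarith
  -- The oriented edge vectors `ε_i - ε_j` with `i < j`: distinct ones have inner product `-1`, `0`
  -- or `1`.
  set N : (Σ _ : Fin m, Fin m) → EuclideanSpace ℝ (Fin m) := fun e =>
    EuclideanSpace.single e.1 1 - EuclideanSpace.single e.2 1 with hN
  have hNN : ∀ e f, inner ℝ (N e) (N f) = (if e.1 = f.1 then (1 : ℝ) else 0)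
      - (if e.1 = f.2 then 1 else 0) - (if e.2 = f.1 then 1 else 0)
      + (if e.2 = f.2 then 1 else 0) := by
    intro e f
    simp only [hN, inner_sub_left, inner_sub_right, EuclideanSpace.inner_single_left,
      PiLp.single_apply, map_one, one_mul]
    ring
  have lap := sum_mul_inner_sq_le s N
    (fun e he => by rw [hNN]; have := (hmem e he).ne; simp [this, this.symm]; norm_num)
    (fun e he f hf hef => by
      have h1 := hmem e he
      have h2 := hmem f hf
      have h3 : ¬ (e.1 = f.1 ∧ e.2 = f.2) := fun h => hef (by
        rcases e with ⟨a, b⟩; rcases f with ⟨c, d⟩; simp_all)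
      rw [hNN]
      split_ifs <;> first | (exfalso; omega) | norm_num)
    (fun e => 2 * q e.1 e.2) lam hlam
    (fun e _ => by positivity) hqle (WithLp.toLp 2 d)
  have hx : ∀ e, inner ℝ (WithLp.toLp 2 d : EuclideanSpace ℝ (Fin m)) (N e) = d e.1 - d e.2 := by
    intro e
    simp [hN, inner_sub_right, EuclideanSpace.inner_single_right]
  have hxx : inner ℝ (WithLp.toLp 2 d : EuclideanSpace ℝ (Fin m)) (WithLp.toLp 2 d)
      = ∑ i, d i ^ 2 := by
    rw [PiLp.inner_apply]
    exact Finset.sum_congr rfl fun i _ => by simp [sq]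
  simp only [hx, hxx, hs, Finset.sum_sigma] at lap
  rw [s1, s2, hdd]
  refine lap.trans ?_
  rw [mul_comm]
  exact mul_le_mul_of_nonneg_left (by linarith) (Finset.sum_nonneg fun i _ => sq_nonneg _)

/-- Both hypotheses and the conclusion are invariant under simultaneous orthogonal conjugation, so
the spectral theorem reduces this to a diagonal `B`. -/
lemma sum_frob_lie_le {ι : Type*} [Fintype ι] {m : ℕ} (B : Matrix (Fin m) (Fin m) ℝ)
    (hB : B.IsSymm) (A : ι → Matrix (Fin m) (Fin m) ℝ) (hA : ∀ a, (A a).IsSymm)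
    (lam : ℝ) (hlam : 0 ≤ lam)
    (h1 : ∀ X : Matrix (Fin m) (Fin m) ℝ, X.IsSymm → ∑ a, frob (A a) X ^ 2 ≤ lam * frob X X)
    (h2 : lam * frob B B ≤ ∑ a, frob (A a) B ^ 2) :
    ∑ a, frob ⁅B, A a⁆ ⁅B, A a⁆ ≤ frob B B * ∑ a, frob (A a) (A a) := by
  have hBh : B.IsHermitian := by
    rw [IsHermitian, conjTranspose_eq_transpose_of_trivial]; exact hB
  obtain ⟨U, d, hU, hU', hd⟩ : ∃ (U : Matrix (Fin m) (Fin m) ℝ) (d : Fin m → ℝ),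
      U * Uᵀ = 1 ∧ Uᵀ * U = 1 ∧ Uᵀ * B * U = diagonal d := by
    refine ⟨hBh.eigenvectorUnitary, hBh.eigenvalues, ?_, ?_, ?_⟩
    · exact Unitary.coe_mul_star_self hBh.eigenvectorUnitary
    · exact Unitary.coe_star_mul_self hBh.eigenvectorUnitary
    · have := hBh.conjStarAlgAut_star_eigenvectorUnitary
      rw [Unitary.conjStarAlgAut_star_apply] at this
      exact this
  have key := sum_frob_lie_diagonal_le d (fun a => Uᵀ * A a * U)
    (fun a => by simp [IsSymm, (hA a).eq, Matrix.mul_assoc]) lam hlam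
    (fun X hX => by
      have h := h1 (U * X * Uᵀ) (by simp [IsSymm, hX.eq, Matrix.mul_assoc])
      have e1 : Uᵀ * (U * X * Uᵀ) * U = X := by
        calc Uᵀ * (U * X * Uᵀ) * U = (Uᵀ * U) * X * (Uᵀ * U) := by simp [Matrix.mul_assoc]
          _ = X := by simp [hU']
      have e2 : ∀ Y, frob Y (U * X * Uᵀ) = frob (Uᵀ * Y * U) X := fun Y => by
        rw [← frob_conj hU, e1]
      rw [e2] at h
      simp only [e2, e1] at h
      exact h)
    (by simpa only [← hd, frob_conj hU] using h2)
  simpa only [← hd, frob_conj hU, lie_conj hU] using key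

/-- The polynomial vanishes at `0` and therefore has a minimum there; `c1` is its derivative. -/
lemma eq_zero_of_forall_quartic_nonneg {c1 c2 c3 c4 : ℝ}
    (h : ∀ t : ℝ, 0 ≤ c1 * t + c2 * t ^ 2 + c3 * t ^ 3 + c4 * t ^ 4) : c1 = 0 := by
  have hd : HasDerivAt (fun t : ℝ => c1 * t + c2 * t ^ 2 + c3 * t ^ 3 + c4 * t ^ 4)
      c1 0 := by
    have := (((((hasDerivAt_id (0 : ℝ)).const_mul c1).add
      ((hasDerivAt_pow 2 (0 : ℝ)).const_mul c2)).add
      ((hasDerivAt_pow 3 (0 : ℝ)).const_mul c3)).add ((hasDerivAt_pow 4 (0 : ℝ)).const_mul c4))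
    exact this.congr_deriv (by simp)
  refine IsLocalMin.hasDerivAt_eq_zero (Filter.Eventually.of_forall fun t => ?_) hd
  simpa using h t

lemma isSymm_sum_smul {n ι : Type*} [Fintype ι] (A : ι → Matrix n n ℝ)
    (hA : ∀ a, (A a).IsSymm) (v : ι → ℝ) : (∑ a, v a • A a).IsSymm := by
  simp [IsSymm, Matrix.transpose_sum, fun a => (hA a).eq]

/-! ### The algebraic DDVV inequality -/

section DDVV

variable {m p : ℕ}

/-- The sum of the squared norms of all commutators of a family of matrices. -/
def lieSum {n : Type*} [Fintype n] [DecidableEq n] (A : Fin p → Matrix n n ℝ) : ℝ :=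
  ∑ a, ∑ b, frob ⁅A a, A b⁆ ⁅A a, A b⁆

/-- The sum of the squared norms of a family of matrices. -/
def normSum {n : Type*} [Fintype n] (A : Fin p → Matrix n n ℝ) : ℝ := ∑ a, frob (A a) (A a)

lemma normSum_nonneg (A : Fin p → Matrix (Fin m) (Fin m) ℝ) : 0 ≤ normSum A :=
  Finset.sum_nonneg fun _ _ => frob_self_nonneg _

lemma lieSum_nonneg (A : Fin p → Matrix (Fin m) (Fin m) ℝ) : 0 ≤ lieSum A :=
  Finset.sum_nonneg fun _ _ => Finset.sum_nonneg fun _ _ => frob_self_nonneg _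

lemma eq_zero_of_normSum_eq_zero {A : Fin p → Matrix (Fin m) (Fin m) ℝ} (h : normSum A = 0)
    (a : Fin p) : A a = 0 :=
  frob_self_eq_zero ((Finset.sum_eq_zero_iff_of_nonneg fun a _ => frob_self_nonneg (A a)).1 h a
    (Finset.mem_univ _))

lemma lieSum_smul (c : ℝ) (A : Fin p → Matrix (Fin m) (Fin m) ℝ) :
    lieSum (fun a => c • A a) = c ^ 4 * lieSum A := by
  simp only [lieSum, Finset.mul_sum]
  refine Finset.sum_congr rfl fun a _ => Finset.sum_congr rfl fun b _ => ?_
  rw [smul_lie, lie_smul, frob_smul_left, frob_smul_left, frob_smul_right, frob_smul_right]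
  ring

lemma normSum_smul (c : ℝ) (A : Fin p → Matrix (Fin m) (Fin m) ℝ) :
    normSum (fun a => c • A a) = c ^ 2 * normSum A := by
  simp only [normSum, Finset.mul_sum]
  refine Finset.sum_congr rfl fun a _ => ?_
  rw [frob_smul_left, frob_smul_right]
  ring

/-- A family of symmetric matrices of total norm one that maximizes the sum of the squared
commutator norms. -/
lemma exists_maximal_family (hne : ∃ A : Fin p → Matrix (Fin m) (Fin m) ℝ,
    (∀ a, (A a).IsSymm) ∧ normSum A = 1) :
    ∃ A : Fin p → Matrix (Fin m) (Fin m) ℝ, (∀ a, (A a).IsSymm) ∧ normSum A = 1 ∧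
      ∀ B : Fin p → Matrix (Fin m) (Fin m) ℝ, (∀ a, (B a).IsSymm) →
        lieSum B ≤ lieSum A * normSum B ^ 2 := by
  set K : Set (Fin p → Matrix (Fin m) (Fin m) ℝ) := {A | (∀ a, (A a).IsSymm) ∧ normSum A = 1}
  have hcn : Continuous (normSum : (Fin p → Matrix (Fin m) (Fin m) ℝ) → ℝ) := by
    unfold normSum frob
    fun_prop
  have hcl : Continuous (lieSum : (Fin p → Matrix (Fin m) (Fin m) ℝ) → ℝ) := by
    unfold lieSum frob
    simp only [Ring.lie_def]
    fun_prop
  have hKc : IsClosed K := by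
    have : {A : Fin p → Matrix (Fin m) (Fin m) ℝ | ∀ a, (A a).IsSymm}
        = ⋂ a, {A | (A a)ᵀ = A a} := by
      ext A; simp [IsSymm]
    have hs : IsClosed {A : Fin p → Matrix (Fin m) (Fin m) ℝ | ∀ a, (A a).IsSymm} := by
      rw [this]
      exact isClosed_iInter fun a => isClosed_eq (by fun_prop) (by fun_prop)
    exact hs.inter (isClosed_eq hcn continuous_const)
  have hbox : IsCompact (Set.pi Set.univ fun _ : Fin p => Set.pi Set.univ fun _ : Fin m =>
      Set.pi Set.univ fun _ : Fin m => Set.Icc (-1 : ℝ) 1) :=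
    isCompact_univ_pi fun _ => isCompact_univ_pi fun _ => isCompact_univ_pi fun _ => isCompact_Icc
  have hK : IsCompact K := by
    refine IsCompact.of_isClosed_subset (s := Set.pi Set.univ fun _ : Fin p =>
      Set.pi Set.univ fun _ : Fin m => Set.pi Set.univ fun _ : Fin m => Set.Icc (-1 : ℝ) 1)
      hbox hKc ?_
    intro (A : Fin p → Matrix (Fin m) (Fin m) ℝ) hA a _ i _ j _
    have h1 : frob (A a) (A a) ≤ 1 := by
      rw [← hA.2]
      exact Finset.single_le_sum (f := fun a => frob (A a) (A a))
        (fun a _ => frob_self_nonneg _) (Finset.mem_univ a)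
    rw [frob_eq_sum] at h1
    have h2 : ∑ j, A a i j * A a i j ≤ 1 := le_trans
      (Finset.single_le_sum (f := fun i => ∑ j, A a i j * A a i j)
        (fun i _ => Finset.sum_nonneg fun j _ => mul_self_nonneg _) (Finset.mem_univ i)) h1
    have h3 : A a i j * A a i j ≤ 1 := le_trans
      (Finset.single_le_sum (f := fun j => A a i j * A a i j)
        (fun j _ => mul_self_nonneg _) (Finset.mem_univ j)) h2
    exact abs_le.1 (abs_le_one_iff_mul_self_le_one.2 h3)
  obtain ⟨A, hA, hmax⟩ := hK.exists_isMaxOn (f := lieSum) hne hcl.continuousOn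
  refine ⟨A, hA.1, hA.2, fun B hB => ?_⟩
  rcases (normSum_nonneg B).eq_or_lt with h0 | hpos
  · have : lieSum B = 0 := by
      simp only [lieSum, eq_zero_of_normSum_eq_zero h0.symm, zero_lie]
      simp [frob]
    rw [this]
    exact mul_nonneg (lieSum_nonneg A) (sq_nonneg _)
  · have hs : √(normSum B) ^ 2 = normSum B := Real.sq_sqrt hpos.le
    have hs0 : √(normSum B) ≠ 0 := (Real.sqrt_pos.2 hpos).ne'
    -- Normalization extends the bound from `K` to all families, since `lieSum` has degree four and
    -- `normSum` degree two.
    have hmem : (fun a => (√(normSum B))⁻¹ • B a) ∈ K := by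
      refine ⟨fun a => (hB a).smul _, ?_⟩
      rw [normSum_smul, inv_pow, hs, inv_mul_cancel₀ hpos.ne']
    have h := hmax hmem
    simp only [Set.mem_ofPred_eq, lieSum_smul] at h
    have h4 : (√(normSum B))⁻¹ ^ 4 = (normSum B ^ 2)⁻¹ := by
      rw [inv_pow, ← hs]
      congr 1
      rw [hs]
      calc √(normSum B) ^ 4 = (√(normSum B) ^ 2) ^ 2 := by ring
        _ = _ := by rw [hs]
    rw [h4, inv_mul_le_iff₀ (by positivity)] at h
    linarith

/-- The first-order condition at a maximal family. -/
lemma sum_frob_lie_eq_of_maximal {A : Fin p → Matrix (Fin m) (Fin m) ℝ}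
    (hA : ∀ a, (A a).IsSymm) (h1 : normSum A = 1)
    (hmax : ∀ B : Fin p → Matrix (Fin m) (Fin m) ℝ, (∀ a, (B a).IsSymm) →
        lieSum B ≤ lieSum A * normSum B ^ 2) (v : Fin p → ℝ) :
    ∑ b, frob ⁅∑ a, v a • A a, A b⁆ ⁅∑ a, v a • A a, A b⁆
      = lieSum A * frob (∑ a, v a • A a) (∑ a, v a • A a) := by
  set C := ∑ a, v a • A a with hC
  have hCs : C.IsSymm := isSymm_sum_smul A hA v
  -- Along the variation `A a + t • v a • C` the commutators are exactly `X a b + t • Y a b`,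
  -- because the quadratic term is a multiple of `⁅C, C⁆ = 0`.
  set X : Fin p → Fin p → Matrix (Fin m) (Fin m) ℝ := fun a b => ⁅A a, A b⁆
  set Y : Fin p → Fin p → Matrix (Fin m) (Fin m) ℝ := fun a b =>
    v b • ⁅A a, C⁆ + v a • ⁅C, A b⁆
  have hnorm : ∀ t : ℝ, normSum (fun a => A a + t • (v a • C))
      = 1 + 2 * t * frob C C + t ^ 2 * ((∑ a, v a ^ 2) * frob C C) := by
    intro t
    have : ∀ a, frob (A a + t • (v a • C)) (A a + t • (v a • C))
        = frob (A a) (A a) + 2 * t * frob (v a • A a) C + t ^ 2 * (v a ^ 2 * frob C C) := by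
      intro a
      simp only [frob_add_left, frob_add_right, frob_smul_left, frob_smul_right, frob_comm C (A a)]
      ring
    simp only [normSum, this, Finset.sum_add_distrib, ← Finset.mul_sum, ← Finset.sum_mul]
    rw [← frob_sum_left, ← hC]
    rw [normSum] at h1
    rw [h1]
  have hlie : ∀ t : ℝ, lieSum (fun a => A a + t • (v a • C))
      = lieSum A + 2 * t * (∑ a, ∑ b, frob (X a b) (Y a b))
        + t ^ 2 * ∑ a, ∑ b, frob (Y a b) (Y a b) := by
    intro t
    have : ∀ a b, ⁅A a + t • (v a • C), A b + t • (v b • C)⁆ = X a b + t • Y a b := by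
      intro a b
      simp only [X, Y, add_lie, lie_add, smul_lie, lie_smul, lie_self, smul_zero, smul_add]
      abel
    simp only [lieSum, this, frob_add_left, frob_add_right, frob_smul_left, frob_smul_right,
      Finset.sum_add_distrib, ← Finset.mul_sum]
    simp only [frob_comm (Y _ _) (X _ _)]
    simp only [X]
    ring
  have hXY : ∑ a, ∑ b, frob (X a b) (Y a b) = 2 * ∑ b, frob ⁅C, A b⁆ ⁅C, A b⁆ := by
    have e1 : ∑ b, ∑ a, v a * frob ⁅A a, A b⁆ ⁅C, A b⁆ = ∑ b, frob ⁅C, A b⁆ ⁅C, A b⁆ := by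
      refine Finset.sum_congr rfl fun b _ => ?_
      have : ⁅C, A b⁆ = ∑ a, v a • ⁅A a, A b⁆ := by
        rw [hC, sum_lie]
        exact Finset.sum_congr rfl fun a _ => smul_lie _ _ _
      nth_rewrite 2 [this]
      rw [frob_sum_left]
      exact Finset.sum_congr rfl fun a _ => by rw [frob_smul_left]
    have e2 : ∀ a b, frob (X a b) (Y a b)
        = v b * frob ⁅A b, A a⁆ ⁅C, A a⁆ + v a * frob ⁅A a, A b⁆ ⁅C, A b⁆ := by
      intro a b
      simp only [X, Y, frob_add_right, frob_smul_right]
      rw [← lie_skew (A a) (A b), ← lie_skew (A a) C, frob_neg_neg, lie_skew]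
    simp only [e2, Finset.sum_add_distrib]
    rw [e1, Finset.sum_comm (f := fun a b => v a * frob ⁅A a, A b⁆ ⁅C, A b⁆), e1]
    ring
  set L := lieSum A
  set c := frob C C
  set V := (∑ a, v a ^ 2) * c
  set Q := ∑ a, ∑ b, frob (Y a b) (Y a b)
  -- The polynomial is `L * normSum ^ 2 - lieSum` along the variation; its constant term is zero
  -- because `normSum A = 1`.
  have hpoly := eq_zero_of_forall_quartic_nonneg
    (c1 := 4 * L * c - 2 * (∑ a, ∑ b, frob (X a b) (Y a b)))
    (c2 := L * (4 * c ^ 2 + 2 * V) - Q) (c3 := 4 * L * c * V) (c4 := L * V ^ 2) fun t => by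
      have h := hmax (fun a => A a + t • (v a • C))
        fun a => (hA a).add ((hCs.smul _).smul _)
      rw [hnorm, hlie] at h
      linarith
  rw [hXY] at hpoly
  linarith

/-- The algebraic DDVV inequality. -/
theorem lieSum_le_normSum_sq (A : Fin p → Matrix (Fin m) (Fin m) ℝ) (hA : ∀ a, (A a).IsSymm) :
    lieSum A ≤ normSum A ^ 2 := by
  by_cases hne : ∃ A : Fin p → Matrix (Fin m) (Fin m) ℝ, (∀ a, (A a).IsSymm) ∧ normSum A = 1
  swap
  -- Without a family of norm one every family is zero, since a nonzero one could be normalized.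
  · have h0 : normSum A = 0 := by
      by_contra h
      have hpos := lt_of_le_of_ne (normSum_nonneg A) (Ne.symm h)
      refine hne ⟨fun a => (√(normSum A))⁻¹ • A a, fun a => (hA a).smul _, ?_⟩
      rw [normSum_smul, inv_pow, Real.sq_sqrt hpos.le, inv_mul_cancel₀ hpos.ne']
    simp only [lieSum, eq_zero_of_normSum_eq_zero h0, zero_lie]
    simp [frob, sq_nonneg]
  obtain ⟨B, hB, h1, hmax⟩ := exists_maximal_family hne
  suffices h : lieSum B ≤ 1 from
    (hmax A hA).trans (mul_le_of_le_one_left (sq_nonneg _) h)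
  have hp : 0 < p := by
    rcases Nat.eq_zero_or_pos p with rfl | h
    · simp [normSum] at h1
    · exact h
  have : Nonempty (Fin p) := ⟨⟨0, hp⟩⟩
  set P : EuclideanSpace ℝ (Fin p) → Matrix (Fin m) (Fin m) ℝ := fun v => ∑ a, v a • B a with hP
  have hPc : Continuous fun v => frob (P v) (P v) := by
    unfold frob
    simp only [hP]
    fun_prop
  obtain ⟨v, hv, hvmax⟩ := (isCompact_sphere (0 : EuclideanSpace ℝ (Fin p)) 1).exists_isMaxOn
    (NormedSpace.sphere_nonempty.2 zero_le_one) hPc.continuousOn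
  have hsph : ∀ w : EuclideanSpace ℝ (Fin p),
      w ∈ Metric.sphere (0 : EuclideanSpace ℝ (Fin p)) 1 ↔ ∑ a, w a ^ 2 = 1 := by
    intro w
    rw [mem_sphere_zero_iff_norm, EuclideanSpace.norm_eq, Real.sqrt_eq_one]
    simp
  have hle : ∀ w : Fin p → ℝ, ∑ a, w a ^ 2 = 1 →
      frob (∑ a, w a • B a) (∑ a, w a • B a) ≤ frob (P v) (P v) := fun w hw =>
    hvmax ((hsph (WithLp.toLp 2 w)).2 hw)
  set lam := frob (P v) (P v) with hlam
  have hlam0 : 0 ≤ lam := frob_self_nonneg _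
  have hlampos : 0 < lam := by
    refine lt_of_le_of_ne hlam0 fun h0 => ?_
    have : normSum B = 0 := by
      refine Finset.sum_eq_zero fun a _ => le_antisymm ?_ (frob_self_nonneg _)
      have := hle (Pi.single a 1) (by simp [Pi.single_apply])
      rw [← h0] at this
      simpa [Pi.single_apply] using this
    rw [this] at h1
    exact zero_ne_one h1
  have hPs : (P v).IsSymm := isSymm_sum_smul B hB v
  -- Here `lam` is the top eigenvalue of the Gram matrix of `B`, hence the maximum of `∑ a, ⟨B a,
  -- X⟩² / ‖X‖²`, attained at `P v`. Both facts are Cauchy–Schwarz; the upper bound tests the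
  -- maximality of `v` against the unit vector proportional to `(⟨B a, X⟩)_a`.
  have key := sum_frob_lie_le (P v) hPs B hB lam hlam0
    (fun X _ => by
      set w : Fin p → ℝ := fun a => frob (B a) X
      set S := ∑ a, w a ^ 2
      have hS0 : 0 ≤ S := Finset.sum_nonneg fun a _ => sq_nonneg _
      rcases hS0.eq_or_lt with h0 | hpos
      · rw [← h0]
        exact mul_nonneg hlam0 (frob_self_nonneg _)
      · have hs : √S ^ 2 = S := Real.sq_sqrt hpos.le
        have hu := hle (fun a => (√S)⁻¹ * w a) (by
          simp only [mul_pow, ← Finset.mul_sum, inv_pow, hs]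
          exact inv_mul_cancel₀ hpos.ne')
        have hcs := frob_sq_le (∑ a, ((√S)⁻¹ * w a) • B a) X
        have e : frob (∑ a, ((√S)⁻¹ * w a) • B a) X = (√S)⁻¹ * S := by
          simp only [frob_sum_left, frob_smul_left, S, Finset.mul_sum]
          exact Finset.sum_congr rfl fun a _ => by simp only [w]; ring
        rw [e, mul_pow, inv_pow, hs, sq, ← mul_assoc, inv_mul_cancel₀ hpos.ne', one_mul] at hcs
        exact hcs.trans (mul_le_mul_of_nonneg_right hu (frob_self_nonneg _)))
    (by
      have hcs := Finset.sum_mul_sq_le_sq_mul_sq Finset.univ (fun a => v a)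
        (fun a => frob (B a) (P v))
      have e : ∑ a, v a * frob (B a) (P v) = lam := by
        rw [hlam]
        nth_rewrite 2 [hP]
        simp only [frob_sum_left, frob_smul_left]
      rw [e, (hsph v).1 hv, one_mul, sq] at hcs
      exact hcs)
  have hfo := sum_frob_lie_eq_of_maximal hB h1 hmax v
  have hn : ∑ a, frob (B a) (B a) = 1 := h1
  rw [hn, mul_one] at key
  have h2 : lieSum B * lam ≤ 1 * lam := by
    rw [one_mul]
    exact hfo.symm.le.trans key
  exact le_of_mul_le_mul_right h2 hlampos

/-! ### The equality condition and its invariance -/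

/-- Equality in the DDVV inequality, for the matrices of the shape operators. -/
def WintgenEq {n : Type*} [Fintype n] [DecidableEq n] (A : Fin p → Matrix n n ℝ) : Prop :=
  ∑ a, (frob (A a) (A a) - trace (A a) ^ 2 / Fintype.card n) = √(lieSum A)

variable {n : Type*} [Fintype n] [DecidableEq n]

lemma wintgenEq_conj {U : Matrix n n ℝ} (hU : U * Uᵀ = 1) (A : Fin p → Matrix n n ℝ) :
    WintgenEq (fun a => Uᵀ * A a * U) ↔ WintgenEq A := by
  have ht : ∀ a, trace (Uᵀ * A a * U) = trace (A a) := fun a => by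
    rw [trace_mul_comm, ← Matrix.mul_assoc, hU, Matrix.one_mul]
  simp only [WintgenEq, lieSum, frob_conj hU, lie_conj hU, ht]

lemma wintgenEq_submatrix {n' : Type*} [Fintype n'] [DecidableEq n'] (σ : n' ≃ n)
    (A : Fin p → Matrix n n ℝ) :
    WintgenEq (fun a => (A a).submatrix σ σ) ↔ WintgenEq A := by
  have h3 : ∀ X : Matrix n n ℝ, trace (X.submatrix σ σ) = trace X := fun X =>
    σ.sum_comp fun i => X i i
  have h1 : ∀ X Y : Matrix n n ℝ, frob (X.submatrix σ σ) (Y.submatrix σ σ) = frob X Y := by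
    intro X Y
    rw [frob, transpose_submatrix, submatrix_mul_equiv, h3, frob]
  have h2 : ∀ X Y : Matrix n n ℝ, ⁅X.submatrix σ σ, Y.submatrix σ σ⁆ = ⁅X, Y⁆.submatrix σ σ := by
    intro X Y
    simp only [Ring.lie_def, submatrix_mul_equiv]
    rfl
  simp only [WintgenEq, lieSum, h1, h2, h3, Fintype.card_congr σ]

lemma lie_add_smul_one (X Y : Matrix n n ℝ) (s t : ℝ) :
    ⁅X + s • (1 : Matrix n n ℝ), Y + t • (1 : Matrix n n ℝ)⁆ = ⁅X, Y⁆ := by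
  simp only [Ring.lie_def, Matrix.add_mul, Matrix.mul_add, smul_mul_assoc, mul_smul_comm,
    Matrix.one_mul, Matrix.mul_one]
  rw [smul_add, smul_add, smul_comm t s]
  abel

lemma frob_add_smul_one (X : Matrix n n ℝ) (t : ℝ) :
    frob (X + t • (1 : Matrix n n ℝ)) (X + t • (1 : Matrix n n ℝ))
      = frob X X + 2 * t * trace X + t ^ 2 * Fintype.card n := by
  have h1 : frob X 1 = trace X := by simp [frob]
  have h2 : frob (1 : Matrix n n ℝ) 1 = Fintype.card n := by simp [frob]
  simp only [frob_add_left, frob_add_right, frob_smul_left, frob_smul_right, frob_comm 1 X, h1, h2]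
  ring

/-- Scalars are central, so they drop out of the commutators, and `‖A a‖² - (tr A a)² / n` is the
squared norm of the trace-free part of `A a`. -/
lemma wintgenEq_add_smul_one [Nonempty n] (A : Fin p → Matrix n n ℝ) (t : Fin p → ℝ) :
    WintgenEq (fun a => A a + t a • (1 : Matrix n n ℝ)) ↔ WintgenEq A := by
  have hn : (Fintype.card n : ℝ) ≠ 0 := by exact_mod_cast Fintype.card_ne_zero
  have ht : ∀ a, trace (A a + t a • (1 : Matrix n n ℝ)) = trace (A a) + t a * Fintype.card n :=
    fun a => by simp
  have h : ∀ a, frob (A a) (A a) + 2 * t a * trace (A a) + t a ^ 2 * Fintype.card n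
      - (trace (A a) + t a * Fintype.card n) ^ 2 / Fintype.card n
      = frob (A a) (A a) - trace (A a) ^ 2 / Fintype.card n := fun a => by
    field_simp
    ring
  simp only [WintgenEq, lieSum, lie_add_smul_one, frob_add_smul_one, ht, h]

/-- This is the algebraic DDVV inequality applied to the trace-free parts, which have the same
commutators. -/
lemma sqrt_lieSum_le (hm : 0 < m) (A : Fin p → Matrix (Fin m) (Fin m) ℝ)
    (hA : ∀ a, (A a).IsSymm) :
    √(lieSum A) ≤ ∑ a, (frob (A a) (A a) - trace (A a) ^ 2 / m) := by
  have hm' : (m : ℝ) ≠ 0 := by exact_mod_cast hm.ne'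
  set t : Fin p → ℝ := fun a => -(trace (A a) / m) with ht
  have h := lieSum_le_normSum_sq (fun a => A a + t a • (1 : Matrix (Fin m) (Fin m) ℝ))
    fun a => (hA a).add (isSymm_one.smul _)
  have h1 : lieSum (fun a => A a + t a • (1 : Matrix (Fin m) (Fin m) ℝ)) = lieSum A := by
    simp only [lieSum, lie_add_smul_one]
  have h2 : normSum (fun a => A a + t a • (1 : Matrix (Fin m) (Fin m) ℝ))
      = ∑ a, (frob (A a) (A a) - trace (A a) ^ 2 / m) := by
    simp only [normSum, frob_add_smul_one]
    refine Finset.sum_congr rfl fun a _ => ?_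
    simp only [ht, Fintype.card_fin]
    field_simp
    ring
  rw [← h2, ← h1]
  exact Real.sqrt_le_iff.2 ⟨normSum_nonneg _, h⟩

/-- Enlarging the shape operators by a zero block and adding multiples of the identity gives
equality in the DDVV inequality exactly if the original operators are trace-free and satisfy
equality. -/
theorem wintgenEq_fromBlocks_iff {r k : ℕ} (hr : 0 < r) (hk : 0 < k)
    (A : Fin p → Matrix (Fin r) (Fin r) ℝ) (hA : ∀ a, (A a).IsSymm) {c : ℝ} (hc : c ≠ 0)
    (t : Fin p → ℝ) :
    WintgenEq (fun a => fromBlocks (c • A a) 0 0 0 + t a • (1 : Matrix (Fin r ⊕ Fin k) _ ℝ)) ↔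
      (∀ a, trace (A a) = 0) ∧ WintgenEq A := by
  have : Nonempty (Fin r ⊕ Fin k) := ⟨Sum.inl ⟨0, hr⟩⟩
  rw [wintgenEq_add_smul_one]
  have hr' : (0 : ℝ) < r := by exact_mod_cast hr
  have hk' : (0 : ℝ) < k := by exact_mod_cast hk
  have hc2 : 0 < c ^ 2 := by positivity
  have h3 : ∀ X : Matrix (Fin r) (Fin r) ℝ,
      trace (fromBlocks X 0 0 (0 : Matrix (Fin k) (Fin k) ℝ)) = trace X := by
    intro X
    simp [trace, Fintype.sum_sum_type]
  have h1 : ∀ X Y : Matrix (Fin r) (Fin r) ℝ,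
      frob (fromBlocks X 0 0 (0 : Matrix (Fin k) (Fin k) ℝ)) (fromBlocks Y 0 0 0) = frob X Y := by
    intro X Y
    simp [frob, fromBlocks_transpose, fromBlocks_multiply, h3]
  have h2 : ∀ X Y : Matrix (Fin r) (Fin r) ℝ,
      ⁅fromBlocks X 0 0 (0 : Matrix (Fin k) (Fin k) ℝ),
        fromBlocks Y 0 0 (0 : Matrix (Fin k) (Fin k) ℝ)⁆
        = fromBlocks ⁅X, Y⁆ 0 0 0 := by
    intro X Y
    simp [Ring.lie_def, fromBlocks_multiply, sub_eq_add_neg, fromBlocks_neg, fromBlocks_add]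
  have hl : lieSum (fun a => fromBlocks (c • A a) 0 0 (0 : Matrix (Fin k) (Fin k) ℝ))
      = (c ^ 2) ^ 2 * lieSum A := by
    rw [← pow_mul, ← lieSum_smul]
    simp only [lieSum, h1, h2]
  set S := ∑ a, frob (A a) (A a) with hS
  set T := ∑ a, trace (A a) ^ 2 with hT
  have hT0 : 0 ≤ T := Finset.sum_nonneg fun a _ => sq_nonneg _
  have e1 : ∑ a, (frob (c • A a) (c • A a) - trace (c • A a) ^ 2 / ((r : ℝ) + k))
      = c ^ 2 * (S - T / (r + k)) := by
    rw [hS, hT, Finset.sum_div, ← Finset.sum_sub_distrib, Finset.mul_sum]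
    refine Finset.sum_congr rfl fun a _ => ?_
    simp only [frob_smul_left, frob_smul_right, trace_smul, smul_eq_mul]
    ring
  have e2 : ∑ a, (frob (A a) (A a) - trace (A a) ^ 2 / (r : ℝ)) = S - T / r := by
    rw [hS, hT, Finset.sum_div, ← Finset.sum_sub_distrib]
  have hineq := sqrt_lieSum_le hr A hA
  have hw1 : WintgenEq (fun a => fromBlocks (c • A a) 0 0 (0 : Matrix (Fin k) (Fin k) ℝ)) ↔
      S - T / (r + k) = √(lieSum A) := by
    simp only [WintgenEq, h1, h3, hl, Fintype.card_sum, Fintype.card_fin, Nat.cast_add, e1]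
    rw [Real.sqrt_mul (by positivity), Real.sqrt_sq hc2.le, mul_right_inj' hc2.ne']
  have hw2 : WintgenEq A ↔ S - T / r = √(lieSum A) := by
    simp only [WintgenEq, Fintype.card_fin, e2]
  rw [hw1, hw2]
  rw [e2] at hineq
  constructor
  · intro h
    -- Equality for the enlarged family and the inequality for the original one give `T / r ≤ T / (r
    -- + k)`. Since `k > 0`, this forces `T = 0`.
    have hT' : T = 0 := by
      refine le_antisymm ?_ hT0
      rw [← h] at hineq
      have h4 : T / r ≤ T / (r + k) := by linarith
      rw [div_le_div_iff₀ hr' (by positivity)] at h4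
      nlinarith
    refine ⟨fun a => ?_, by rw [← h, hT']; simp⟩
    exact pow_eq_zero_iff two_ne_zero |>.1
      ((Finset.sum_eq_zero_iff_of_nonneg fun a _ => sq_nonneg _).1 hT' a (Finset.mem_univ _))
  · rintro ⟨h, h'⟩
    have hT' : T = 0 := by simp [hT, h]
    rw [hT'] at h' ⊢
    simpa using h'

end DDVV

end Algebra

/-! ### Immersions into space forms: induced connection and Gauss formula -/

section Geometry

variable {E : Type*} [NormedAddCommGroup E] [NormedSpace ℝ E]
variable {V : Type*} [NormedAddCommGroup V] [NormedSpace ℝ V]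

lemma isInvertible_of_pos [FiniteDimensional ℝ E] {b : E →L[ℝ] E →L[ℝ] ℝ}
    (hb : ∀ v, v ≠ 0 → 0 < b v v) : b.IsInvertible := by
  have hinj : Function.Injective b.toLinearMap := by
    rw [← LinearMap.ker_eq_bot, LinearMap.ker_eq_bot']
    intro v hv
    by_contra h
    have h1 := hb v h
    have h2 : b v = 0 := hv
    simp [h2] at h1
  have hfin : Module.finrank ℝ E = Module.finrank ℝ (E →L[ℝ] ℝ) := by
    rw [← LinearEquiv.finrank_eq (LinearMap.toContinuousLinearMap : (E →ₗ[ℝ] ℝ) ≃ₗ[ℝ] E →L[ℝ] ℝ)]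
    exact (Subspace.dual_finrank_eq (K := ℝ) (V := E)).symm
  exact ⟨(LinearMap.linearEquivOfInjective b.toLinearMap hinj hfin).toContinuousLinearEquiv,
    by ext; rfl⟩

lemma eq_of_form_eq {b : E →L[ℝ] E →L[ℝ] ℝ} (hb : ∀ v, v ≠ 0 → 0 < b v v) {v w : E}
    (h : ∀ z, b v z = b w z) : v = w := by
  by_contra hne
  have h1 := hb (v - w) (sub_ne_zero.2 hne)
  simp [h] at h1

/-- The Koszul formula: a tensor that satisfies the algebraic properties of the Levi-Civita
connection computes the Christoffel symbols. -/
lemma metric_christoffel [FiniteDimensional ℝ E] {g : MetricField E} {y : E}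
    (hb : ∀ v, v ≠ 0 → 0 < g y v v) (K : E → E → E → ℝ)
    (hsymm : ∀ v w z, K v w z = K w v z)
    (hcompat : ∀ v w z, fderiv ℝ g y v w z = K v w z + K v z w) (v w z : E) :
    g y (christoffel g y v w) z = K v w z := by
  rw [christoffel, map_smul, (isInvertible_of_pos hb).self_apply_inverse]
  simp only [_root_.smul_apply, _root_.sub_apply,
    _root_.add_apply, ContinuousLinearMap.flip_apply, hcompat, smul_eq_mul]
  rw [hsymm w v z, hsymm z v w, hsymm z w v]
  ring

/-- A Riemannian metric `G` of constant curvature `c` on the open set `U`, with Levi-Civita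
connection given by the symbols `Γ`. -/
structure IsSpaceForm (G : MetricField V) (Γ : V → V →L[ℝ] V →L[ℝ] V) (U : Set V) (c : ℝ) :
    Prop where
  isOpen : IsOpen U
  smooth : ∀ y ∈ U, ContDiffAt ℝ ∞ G y
  symm : ∀ y ∈ U, ∀ v w, G y v w = G y w v
  pos : ∀ y ∈ U, ∀ v, v ≠ 0 → 0 < G y v v
  conn_smooth : ∀ y ∈ U, ContDiffAt ℝ ∞ Γ y
  conn_symm : ∀ y ∈ U, ∀ v w, Γ y v w = Γ y w v
  compat : ∀ y ∈ U, ∀ v w z, fderiv ℝ G y v w z = G y (Γ y v w) z + G y w (Γ y v z)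
  curv : ∀ y ∈ U, ∀ X Y Z, (fderiv ℝ Γ y X Y Z + Γ y X (Γ y Y Z))
    - (fderiv ℝ Γ y Y X Z + Γ y Y (Γ y X Z)) = c • (G y Y Z • X - G y X Z • Y)

/-- `F` is a smooth immersion of the open set `W` into `U`. -/
structure IsImmersionOn (F : E → V) (W : Set E) (U : Set V) : Prop where
  isOpen : IsOpen W
  smooth : ∀ q ∈ W, ContDiffAt ℝ ∞ F q
  mapsTo : ∀ q ∈ W, F q ∈ U
  inj : ∀ q ∈ W, Function.Injective (fderiv ℝ F q)

/-- The Levi-Civita connection is unique: symmetry and metric compatibility determine it through the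
Koszul formula. This replaces `christoffel`, which involves an inverse of the metric, by explicit
smooth symbols. -/
lemma IsSpaceForm.christoffel_eq [FiniteDimensional ℝ V] {G : MetricField V}
    {Γ : V → V →L[ℝ] V →L[ℝ] V} {U : Set V} {c : ℝ} (hG : IsSpaceForm G Γ U c) {y : V}
    (hy : y ∈ U) (v w : V) : christoffel G y v w = Γ y v w := by
  refine eq_of_form_eq (hG.pos y hy) fun z => ?_
  refine metric_christoffel (hG.pos y hy) (fun v w z => G y (Γ y v w) z)
    (fun v w z => by rw [hG.conn_symm y hy]) (fun v w z => ?_) v w z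
  rw [hG.compat y hy, hG.symm y hy w]

/-- The covariant derivative along `F` for the connection with symbols `Γ`. -/
noncomputable def covDeriv (Γ : V → V →L[ℝ] V →L[ℝ] V) (F : E → V) (X : E) (ξ : E → V) (q : E) : V :=
  fderiv ℝ ξ q X + Γ (F q) (fderiv ℝ F q X) (ξ q)

section Basic

variable {G : MetricField V} {Γ : V → V →L[ℝ] V →L[ℝ] V} {U : Set V} {c : ℝ}
variable {F : E → V} {W : Set E}

lemma contDiffAt_fderiv_apply {ξ : E → V} {q : E} (h : ContDiffAt ℝ ∞ ξ q) (X : E) :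
    ContDiffAt ℝ ∞ (fun q => fderiv ℝ ξ q X) q :=
  (h.fderiv_right (m := ∞) le_rfl).clm_apply contDiffAt_const

lemma ambientDeriv_eq [FiniteDimensional ℝ V] (hG : IsSpaceForm G Γ U c)
    (hF : IsImmersionOn F W U) {q : E} (hq : q ∈ W) (X : E) (ξ : E → V) :
    ambientDeriv G F X ξ q = covDeriv Γ F X ξ q := by
  rw [ambientDeriv, covDeriv, hG.christoffel_eq (hF.mapsTo q hq)]

lemma contDiffAt_covDeriv (hG : IsSpaceForm G Γ U c) (hF : IsImmersionOn F W U) {q : E}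
    (hq : q ∈ W) (X : E) {ξ : E → V} (hξ : ContDiffAt ℝ ∞ ξ q) :
    ContDiffAt ℝ ∞ (covDeriv Γ F X ξ) q := by
  have hF' := hF.smooth q hq
  exact (contDiffAt_fderiv_apply hξ X).add ((((hG.conn_smooth _ (hF.mapsTo q hq)).comp q
    hF').clm_apply (contDiffAt_fderiv_apply hF' X)).clm_apply hξ)

lemma fderiv_metric_apply (hG : IsSpaceForm G Γ U c) (hF : IsImmersionOn F W U) {q : E}
    (hq : q ∈ W) {ξ η : E → V} (hξ : DifferentiableAt ℝ ξ q) (hη : DifferentiableAt ℝ η q)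
    (X : E) :
    fderiv ℝ (fun q => G (F q) (ξ q) (η q)) q X
      = G (F q) (covDeriv Γ F X ξ q) (η q) + G (F q) (ξ q) (covDeriv Γ F X η q) := by
  have hFq := hF.mapsTo q hq
  have hG' : HasFDerivAt G (fderiv ℝ G (F q)) (F q) :=
    ((hG.smooth _ hFq).differentiableAt (by simp)).hasFDerivAt
  have hF' : HasFDerivAt F (fderiv ℝ F q) q :=
    ((hF.smooth q hq).differentiableAt (by simp)).hasFDerivAt
  have h0 : HasFDerivAt (fun q => G (F q)) (fderiv ℝ G (F q) ∘L fderiv ℝ F q) q :=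
    HasFDerivAt.comp (𝕜 := ℝ) (g := G) q hG' hF'
  have h := (h0.clm_apply hξ.hasFDerivAt).clm_apply hη.hasFDerivAt
  have h2 : fderiv ℝ (fun q => G (F q) (ξ q) (η q)) q = _ := h.fderiv
  rw [h2]
  simp only [covDeriv, _root_.add_apply, ContinuousLinearMap.comp_apply,
    ContinuousLinearMap.flip_apply, hG.compat _ hFq, map_add]
  ring

lemma inducedMetric_apply (G : MetricField V) (F : E → V) (q v w : E) :
    inducedMetric G F q v w = G (F q) (fderiv ℝ F q v) (fderiv ℝ F q w) := rfl

lemma inducedMetric_pos (hG : IsSpaceForm G Γ U c) (hF : IsImmersionOn F W U) {q : E}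
    (hq : q ∈ W) (v : E) (hv : v ≠ 0) : 0 < inducedMetric G F q v v :=
  hG.pos _ (hF.mapsTo q hq) _ fun h => hv (hF.inj q hq (h.trans (map_zero _).symm))

lemma inducedMetric_symm (hG : IsSpaceForm G Γ U c) (hF : IsImmersionOn F W U) {q : E}
    (hq : q ∈ W) (v w : E) : inducedMetric G F q v w = inducedMetric G F q w v :=
  hG.symm _ (hF.mapsTo q hq) _ _

lemma contDiffAt_metric_comp (hG : IsSpaceForm G Γ U c) (hF : IsImmersionOn F W U) {q : E}
    (hq : q ∈ W) : ContDiffAt ℝ ∞ (fun q => G (F q)) q :=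
  (hG.smooth _ (hF.mapsTo q hq)).comp q (hF.smooth q hq)

lemma contDiff_flip : ContDiff ℝ ∞ (fun b : E →L[ℝ] V →L[ℝ] ℝ => b.flip) :=
  LinearIsometryEquiv.contDiff (𝕜 := ℝ) (E := E →L[ℝ] V →L[ℝ] ℝ) (F := V →L[ℝ] E →L[ℝ] ℝ)
    (ContinuousLinearMap.flipₗᵢ ℝ E V ℝ)

lemma contDiffAt_inducedMetric (hG : IsSpaceForm G Γ U c) (hF : IsImmersionOn F W U) {q : E}
    (hq : q ∈ W) : ContDiffAt ℝ ∞ (inducedMetric G F) q := by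
  have h1 : ContDiffAt ℝ ∞ (fderiv ℝ F) q := (hF.smooth q hq).fderiv_right (m := ∞) le_rfl
  -- Precomposition in both arguments is written as composition, flip, composition, flip, so that
  -- each stage is a smooth operation on continuous linear maps.
  have h2 := (contDiff_flip.contDiffAt.comp q
    ((contDiffAt_metric_comp hG hF hq).clm_comp h1)).clm_comp h1
  exact contDiff_flip.contDiffAt.comp q h2

lemma fderiv_inducedMetric (hG : IsSpaceForm G Γ U c) (hF : IsImmersionOn F W U) {q : E}
    (hq : q ∈ W) (X Y Z : E) :
    fderiv ℝ (inducedMetric G F) q X Y Z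
      = G (F q) (covDeriv Γ F X (fun q => fderiv ℝ F q Y) q) (fderiv ℝ F q Z)
        + G (F q) (covDeriv Γ F X (fun q => fderiv ℝ F q Z) q) (fderiv ℝ F q Y) := by
  have hF' := hF.smooth q hq
  have hd := (contDiffAt_inducedMetric hG hF hq).differentiableAt (by simp)
  have h1 : fderiv ℝ (inducedMetric G F) q X Y Z
      = fderiv ℝ (fun q => inducedMetric G F q Y Z) q X := by
    have := (hd.hasFDerivAt.clm_apply (hasFDerivAt_const Y q)).clm_apply (hasFDerivAt_const Z q)
    rw [this.fderiv]
    simp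
  rw [h1]
  simp only [inducedMetric_apply]
  rw [fderiv_metric_apply hG hF hq ((contDiffAt_fderiv_apply hF' Y).differentiableAt (by simp))
    ((contDiffAt_fderiv_apply hF' Z).differentiableAt (by simp)),
    hG.symm _ (hF.mapsTo q hq) (fderiv ℝ F q Y)]

lemma fderiv_fderiv_apply {ξ : E → V} {q : E} (h : ContDiffAt ℝ ∞ ξ q) (X Y : E) :
    fderiv ℝ (fun q => fderiv ℝ ξ q Y) q X = fderiv ℝ (fderiv ℝ ξ) q X Y := by
  have hd : DifferentiableAt ℝ (fderiv ℝ ξ) q :=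
    (h.fderiv_right (m := ∞) le_rfl).differentiableAt (by simp)
  rw [(hd.hasFDerivAt.clm_apply (hasFDerivAt_const Y q)).fderiv]
  simp

lemma fderiv_fderiv_comm {ξ : E → V} {q : E} (h : ContDiffAt ℝ ∞ ξ q) (X Y : E) :
    fderiv ℝ (fun q => fderiv ℝ ξ q Y) q X = fderiv ℝ (fun q => fderiv ℝ ξ q X) q Y := by
  rw [fderiv_fderiv_apply h, fderiv_fderiv_apply h]
  exact h.isSymmSndFDerivAt (by simpa using WithTop.coe_le_coe.2 (le_top (a := (2 : ℕ∞)))) X Y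

lemma covDeriv_symm (hG : IsSpaceForm G Γ U c) (hF : IsImmersionOn F W U) {q : E}
    (hq : q ∈ W) (X Y : E) :
    covDeriv Γ F X (fun q => fderiv ℝ F q Y) q = covDeriv Γ F Y (fun q => fderiv ℝ F q X) q := by
  rw [covDeriv, covDeriv, fderiv_fderiv_comm (hF.smooth q hq),
    hG.conn_symm _ (hF.mapsTo q hq)]

/-- The tangential part of the ambient derivative is torsion-free, since second derivatives are
symmetric, and compatible with the induced metric. The Koszul formula therefore identifies it with
the induced Levi-Civita connection. -/
lemma inducedMetric_christoffel [FiniteDimensional ℝ E] (hG : IsSpaceForm G Γ U c)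
    (hF : IsImmersionOn F W U) {q : E} (hq : q ∈ W) (X Y Z : E) :
    inducedMetric G F q (christoffel (inducedMetric G F) q X Y) Z
      = G (F q) (covDeriv Γ F X (fun q => fderiv ℝ F q Y) q) (fderiv ℝ F q Z) :=
  metric_christoffel (inducedMetric_pos hG hF hq)
    (fun X Y Z => G (F q) (covDeriv Γ F X (fun q => fderiv ℝ F q Y) q) (fderiv ℝ F q Z))
    (fun X Y Z => by rw [covDeriv_symm hG hF hq])
    (fun X Y Z => fderiv_inducedMetric hG hF hq X Y Z) X Y Z

/-- The vector whose image is the tangential part of `w`. -/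
noncomputable def tangentPart (G : MetricField V) (F : E → V) (q : E) (w : V) : E :=
  (inducedMetric G F q).inverse ((G (F q) w).comp (fderiv ℝ F q))

lemma normalProj_eq (G : MetricField V) (F : E → V) (q : E) (w : V) :
    normalProj G F q w = w - fderiv ℝ F q (tangentPart G F q w) := rfl

lemma normalProj_add_tangentPart (G : MetricField V) (F : E → V) (q : E) (w : V) :
    w = normalProj G F q w + fderiv ℝ F q (tangentPart G F q w) := by
  rw [normalProj_eq, sub_add_cancel]

lemma inducedMetric_tangentPart [FiniteDimensional ℝ E] (hG : IsSpaceForm G Γ U c)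
    (hF : IsImmersionOn F W U) {q : E} (hq : q ∈ W) (w : V) (v : E) :
    inducedMetric G F q (tangentPart G F q w) v = G (F q) w (fderiv ℝ F q v) := by
  rw [tangentPart, (isInvertible_of_pos (inducedMetric_pos hG hF hq)).self_apply_inverse]
  rfl

lemma metric_normalProj_tangent [FiniteDimensional ℝ E] (hG : IsSpaceForm G Γ U c)
    (hF : IsImmersionOn F W U) {q : E} (hq : q ∈ W) (w : V) (v : E) :
    G (F q) (normalProj G F q w) (fderiv ℝ F q v) = 0 := by
  rw [normalProj_eq, map_sub, _root_.sub_apply, ← inducedMetric_apply,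
    inducedMetric_tangentPart hG hF hq, sub_self]

lemma metric_normalProj_normal (hG : IsSpaceForm G Γ U c) (hF : IsImmersionOn F W U) {q : E}
    (hq : q ∈ W) (w : V) {ν : V} (hν : ∀ v, G (F q) ν (fderiv ℝ F q v) = 0) :
    G (F q) (normalProj G F q w) ν = G (F q) w ν := by
  rw [normalProj_eq, map_sub, _root_.sub_apply, hG.symm _ (hF.mapsTo q hq)
    (fderiv ℝ F q _), hν, sub_zero]

lemma normalProj_of_normal [FiniteDimensional ℝ E] (hG : IsSpaceForm G Γ U c)
    (hF : IsImmersionOn F W U) {q : E} (hq : q ∈ W) {ν : V}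
    (hν : ∀ v, G (F q) ν (fderiv ℝ F q v) = 0) : normalProj G F q ν = ν := by
  have : tangentPart G F q ν = 0 := by
    refine eq_of_form_eq (inducedMetric_pos hG hF hq) fun z => ?_
    rw [inducedMetric_tangentPart hG hF hq, hν]
    simp
  rw [normalProj_eq, this, map_zero, sub_zero]

lemma contDiffAt_inverse_inducedMetric [FiniteDimensional ℝ E] (hG : IsSpaceForm G Γ U c)
    (hF : IsImmersionOn F W U) {q : E} (hq : q ∈ W) :
    ContDiffAt ℝ ∞ (fun q => (inducedMetric G F q).inverse) q := by
  have : CompleteSpace E := FiniteDimensional.complete ℝ E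
  exact (isInvertible_of_pos (inducedMetric_pos hG hF hq)).contDiffAt_map_inverse.comp q
    (contDiffAt_inducedMetric hG hF hq)

lemma contDiffAt_tangentPart [FiniteDimensional ℝ E] (hG : IsSpaceForm G Γ U c)
    (hF : IsImmersionOn F W U) {q : E} (hq : q ∈ W) {ξ : E → V} (hξ : ContDiffAt ℝ ∞ ξ q) :
    ContDiffAt ℝ ∞ (fun q => tangentPart G F q (ξ q)) q :=
  (contDiffAt_inverse_inducedMetric hG hF hq).clm_apply
    (((contDiffAt_metric_comp hG hF hq).clm_apply hξ).clm_comp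
      ((hF.smooth q hq).fderiv_right (m := ∞) le_rfl))

lemma contDiffAt_normalProj [FiniteDimensional ℝ E] (hG : IsSpaceForm G Γ U c)
    (hF : IsImmersionOn F W U) {q : E} (hq : q ∈ W) {ξ : E → V} (hξ : ContDiffAt ℝ ∞ ξ q) :
    ContDiffAt ℝ ∞ (fun q => normalProj G F q (ξ q)) q :=
  hξ.sub (((hF.smooth q hq).fderiv_right (m := ∞) le_rfl).clm_apply
    (contDiffAt_tangentPart hG hF hq hξ))

variable [FiniteDimensional ℝ E] [FiniteDimensional ℝ V]

lemma secondFundamentalForm_eq (hG : IsSpaceForm G Γ U c) (hF : IsImmersionOn F W U) {q : E}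
    (hq : q ∈ W) (X Y : E) :
    secondFundamentalForm G F q X Y
      = normalProj G F q (covDeriv Γ F X (fun q => fderiv ℝ F q Y) q) := by
  rw [secondFundamentalForm, ambientDeriv_eq hG hF hq]

/-- The Gauss formula. -/
lemma covDeriv_fderiv_eq (hG : IsSpaceForm G Γ U c) (hF : IsImmersionOn F W U) {q : E}
    (hq : q ∈ W) (X Y : E) :
    covDeriv Γ F X (fun q => fderiv ℝ F q Y) q = secondFundamentalForm G F q X Y
      + fderiv ℝ F q (christoffel (inducedMetric G F) q X Y) := by
  have : christoffel (inducedMetric G F) q X Y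
      = tangentPart G F q (covDeriv Γ F X (fun q => fderiv ℝ F q Y) q) :=
    eq_of_form_eq (inducedMetric_pos hG hF hq) fun z => by
      rw [inducedMetric_christoffel hG hF hq, inducedMetric_tangentPart hG hF hq]
  rw [this, secondFundamentalForm_eq hG hF hq, ← normalProj_add_tangentPart]

lemma metric_secondFundamentalForm_tangent (hG : IsSpaceForm G Γ U c) (hF : IsImmersionOn F W U)
    {q : E} (hq : q ∈ W) (X Y Z : E) :
    G (F q) (secondFundamentalForm G F q X Y) (fderiv ℝ F q Z) = 0 :=
  metric_normalProj_tangent hG hF hq _ _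

lemma metric_secondFundamentalForm_normal (hG : IsSpaceForm G Γ U c) (hF : IsImmersionOn F W U)
    {q : E} (hq : q ∈ W) (X Y : E) {ν : V} (hν : ∀ v, G (F q) ν (fderiv ℝ F q v) = 0) :
    G (F q) (secondFundamentalForm G F q X Y) ν
      = G (F q) (covDeriv Γ F X (fun q => fderiv ℝ F q Y) q) ν := by
  rw [secondFundamentalForm_eq hG hF hq, metric_normalProj_normal hG hF hq _ hν]

lemma secondFundamentalForm_symm (hG : IsSpaceForm G Γ U c) (hF : IsImmersionOn F W U)
    {q : E} (hq : q ∈ W) (X Y : E) :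
    secondFundamentalForm G F q X Y = secondFundamentalForm G F q Y X := by
  rw [secondFundamentalForm_eq hG hF hq, secondFundamentalForm_eq hG hF hq,
    covDeriv_symm hG hF hq]

end Basic

end Geometry

/-! ### The Gauss and Ricci equations -/

section Geometry

variable {E : Type*} [NormedAddCommGroup E] [NormedSpace ℝ E]
variable {V : Type*} [NormedAddCommGroup V] [NormedSpace ℝ V]
variable {G : MetricField V} {Γ : V → V →L[ℝ] V →L[ℝ] V} {U : Set V} {c : ℝ}
variable {F : E → V} {W : Set E}

lemma covDeriv_congr {ξ η : E → V} {q : E} (h : ξ =ᶠ[𝓝 q] η) (X : E) :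
    covDeriv Γ F X ξ q = covDeriv Γ F X η q := by
  rw [covDeriv, covDeriv, h.fderiv_eq, h.eq_of_nhds]

lemma covDeriv_add {ξ η : E → V} {q : E} (hξ : DifferentiableAt ℝ ξ q)
    (hη : DifferentiableAt ℝ η q) (X : E) :
    covDeriv Γ F X (fun q => ξ q + η q) q = covDeriv Γ F X ξ q + covDeriv Γ F X η q := by
  have : fderiv ℝ (fun q => ξ q + η q) q = fderiv ℝ ξ q + fderiv ℝ η q := fderiv_add hξ hη
  simp only [covDeriv, this, _root_.add_apply, map_add]
  abel

/-- The covariant derivatives along `F` commute up to the curvature of the ambient space. -/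
lemma covDeriv_comm (hG : IsSpaceForm G Γ U c) (hF : IsImmersionOn F W U) {q : E}
    (hq : q ∈ W) (X Y : E) {ξ : E → V} (hξ : ContDiffAt ℝ ∞ ξ q) :
    covDeriv Γ F X (covDeriv Γ F Y ξ) q - covDeriv Γ F Y (covDeriv Γ F X ξ) q
      = c • (G (F q) (fderiv ℝ F q Y) (ξ q) • fderiv ℝ F q X
          - G (F q) (fderiv ℝ F q X) (ξ q) • fderiv ℝ F q Y) := by
  have hFq := hF.mapsTo q hq
  have hFs := hF.smooth q hq
  have hΓ' : HasFDerivAt (fun q => Γ (F q)) (fderiv ℝ Γ (F q) ∘L fderiv ℝ F q) q :=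
    HasFDerivAt.comp (𝕜 := ℝ) (g := Γ) q
      ((hG.conn_smooth _ hFq).differentiableAt (by simp)).hasFDerivAt
      (hFs.differentiableAt (by simp)).hasFDerivAt
  have key : ∀ X Y, covDeriv Γ F X (covDeriv Γ F Y ξ) q
      = fderiv ℝ (fun q => fderiv ℝ ξ q Y) q X
        + fderiv ℝ Γ (F q) (fderiv ℝ F q X) (fderiv ℝ F q Y) (ξ q)
        + Γ (F q) (fderiv ℝ (fun q => fderiv ℝ F q Y) q X) (ξ q)
        + Γ (F q) (fderiv ℝ F q Y) (fderiv ℝ ξ q X)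
        + Γ (F q) (fderiv ℝ F q X) (fderiv ℝ ξ q Y)
        + Γ (F q) (fderiv ℝ F q X) (Γ (F q) (fderiv ℝ F q Y) (ξ q)) := by
    intro X Y
    have h1 := ((contDiffAt_fderiv_apply hξ Y).differentiableAt (by simp)).hasFDerivAt
    have h2 := ((contDiffAt_fderiv_apply hFs Y).differentiableAt (by simp)).hasFDerivAt
    have h3 := (hξ.differentiableAt (by simp)).hasFDerivAt
    have h4 := h1.add ((hΓ'.clm_apply h2).clm_apply h3)
    have h5 : fderiv ℝ (covDeriv Γ F Y ξ) q = _ := h4.fderiv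
    rw [covDeriv, h5]
    simp only [covDeriv, _root_.add_apply, ContinuousLinearMap.comp_apply,
      ContinuousLinearMap.flip_apply, map_add]
    abel
  -- The terms with second derivatives of `ξ` and `F`, and the two mixed first-order terms together,
  -- are symmetric in `X` and `Y`. The difference leaves only the curvature expression in `Γ`.
  rw [key, key, fderiv_fderiv_comm hξ X Y, fderiv_fderiv_comm hFs X Y,
    ← hG.curv _ hFq]
  abel

variable [FiniteDimensional ℝ E] [FiniteDimensional ℝ V]

/-- By the Koszul identification the symbol agrees near `q` with the tangential part of a smooth
field. This smoothness is needed to differentiate the Gauss formula once more. -/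
lemma contDiffAt_christoffel_inducedMetric (hG : IsSpaceForm G Γ U c) (hF : IsImmersionOn F W U)
    {q : E} (hq : q ∈ W) (Y Z : E) :
    ContDiffAt ℝ ∞ (fun q => christoffel (inducedMetric G F) q Y Z) q := by
  have hev : (fun q => christoffel (inducedMetric G F) q Y Z)
      =ᶠ[𝓝 q] fun q => tangentPart G F q (covDeriv Γ F Y (fun q => fderiv ℝ F q Z) q) := by
    filter_upwards [hF.isOpen.mem_nhds hq] with q' hq'
    refine eq_of_form_eq (inducedMetric_pos hG hF hq') fun z => ?_
    rw [inducedMetric_christoffel hG hF hq', inducedMetric_tangentPart hG hF hq']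
  exact (contDiffAt_tangentPart hG hF hq (contDiffAt_covDeriv hG hF hq Y
    (contDiffAt_fderiv_apply (hF.smooth q hq) Z))).congr_of_eventuallyEq hev

lemma contDiffAt_secondFundamentalForm (hG : IsSpaceForm G Γ U c) (hF : IsImmersionOn F W U)
    {q : E} (hq : q ∈ W) (Y Z : E) :
    ContDiffAt ℝ ∞ (fun q => secondFundamentalForm G F q Y Z) q := by
  have hev : (fun q => secondFundamentalForm G F q Y Z)
      =ᶠ[𝓝 q] fun q => normalProj G F q (covDeriv Γ F Y (fun q => fderiv ℝ F q Z) q) := by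
    filter_upwards [hF.isOpen.mem_nhds hq] with q' hq'
    exact secondFundamentalForm_eq hG hF hq' Y Z
  exact (contDiffAt_normalProj hG hF hq (contDiffAt_covDeriv hG hF hq Y
    (contDiffAt_fderiv_apply (hF.smooth q hq) Z))).congr_of_eventuallyEq hev

/-- The covariant derivative of a tangential field. -/
lemma covDeriv_fderiv_field (hG : IsSpaceForm G Γ U c) (hF : IsImmersionOn F W U)
    {q : E} (hq : q ∈ W) (X : E) {ζ : E → E} (hζ : DifferentiableAt ℝ ζ q) :
    covDeriv Γ F X (fun q => fderiv ℝ F q (ζ q)) q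
      = fderiv ℝ F q (fderiv ℝ ζ q X + christoffel (inducedMetric G F) q X (ζ q))
        + secondFundamentalForm G F q X (ζ q) := by
  have hFs := hF.smooth q hq
  have hd : DifferentiableAt ℝ (fderiv ℝ F) q :=
    (hFs.fderiv_right (m := ∞) le_rfl).differentiableAt (by simp)
  have h1 : fderiv ℝ (fun q => fderiv ℝ F q (ζ q)) q = _ :=
    (hd.hasFDerivAt.clm_apply hζ.hasFDerivAt).fderiv
  have h2 := covDeriv_fderiv_eq hG hF hq X (ζ q)
  rw [covDeriv, fderiv_fderiv_apply hFs] at h2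
  rw [covDeriv, h1, map_add, add_assoc, add_comm (fderiv ℝ F q (christoffel _ _ _ _)), ← h2]
  simp only [_root_.add_apply, ContinuousLinearMap.comp_apply, ContinuousLinearMap.flip_apply]
  abel

/-- The derivative of the normality relation. -/
lemma metric_covDeriv_normal_tangent (hG : IsSpaceForm G Γ U c) (hF : IsImmersionOn F W U)
    {q : E} (hq : q ∈ W) (X Z : E) {ξ : E → V} (hξ : ContDiffAt ℝ ∞ ξ q)
    (hn : ∀ q ∈ W, ∀ v, G (F q) (ξ q) (fderiv ℝ F q v) = 0) :
    G (F q) (covDeriv Γ F X ξ q) (fderiv ℝ F q Z)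
      = - G (F q) (secondFundamentalForm G F q X Z) (ξ q) := by
  have hFs := hF.smooth q hq
  have h := fderiv_metric_apply hG hF hq (hξ.differentiableAt (by simp))
    ((contDiffAt_fderiv_apply hFs Z).differentiableAt (by simp)) X
  have h0 : (fun q => G (F q) (ξ q) (fderiv ℝ F q Z)) =ᶠ[𝓝 q] fun _ => 0 := by
    filter_upwards [hF.isOpen.mem_nhds hq] with q' hq' using hn q' hq' Z
  rw [h0.fderiv_eq] at h
  rw [metric_secondFundamentalForm_normal hG hF hq _ _ (hn q hq),
    hG.symm _ (hF.mapsTo q hq) (covDeriv _ _ _ _ _) (ξ q)]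
  simp only [fderiv_fun_const, Pi.zero_apply, _root_.zero_apply] at h
  linarith

/-- The Gauss equation. -/
theorem gauss_equation (hG : IsSpaceForm G Γ U c) (hF : IsImmersionOn F W U)
    {q : E} (hq : q ∈ W) (X Y Z T : E) :
    inducedMetric G F q (riemannCurvature (inducedMetric G F) q X Y Z) T
      = c * (inducedMetric G F q Y Z * inducedMetric G F q X T
          - inducedMetric G F q X Z * inducedMetric G F q Y T)
        + G (F q) (secondFundamentalForm G F q Y Z) (secondFundamentalForm G F q X T)
        - G (F q) (secondFundamentalForm G F q X Z) (secondFundamentalForm G F q Y T) := by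
  have hFs := hF.smooth q hq
  -- The Gauss formula is differentiated and paired with a tangent vector: its tangential part gives
  -- the intrinsic second derivative, while its normal part gives the product of second fundamental
  -- forms because of its normality.
  have key : ∀ X Y, G (F q) (covDeriv Γ F X (covDeriv Γ F Y fun q => fderiv ℝ F q Z) q)
      (fderiv ℝ F q T) = inducedMetric G F q (fderiv ℝ (fun q => christoffel (inducedMetric G F)
        q Y Z) q X + christoffel (inducedMetric G F) q X (christoffel (inducedMetric G F) q Y Z)) T
        - G (F q) (secondFundamentalForm G F q Y Z) (secondFundamentalForm G F q X T) := by
    intro X Y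
    have hev : (covDeriv Γ F Y fun q => fderiv ℝ F q Z) =ᶠ[𝓝 q] fun q =>
        secondFundamentalForm G F q Y Z
          + fderiv ℝ F q (christoffel (inducedMetric G F) q Y Z) := by
      filter_upwards [hF.isOpen.mem_nhds hq] with q' hq'
      exact covDeriv_fderiv_eq hG hF hq' Y Z
    have hII := contDiffAt_secondFundamentalForm hG hF hq Y Z
    have hch := contDiffAt_christoffel_inducedMetric hG hF hq Y Z
    rw [covDeriv_congr hev, covDeriv_add (hII.differentiableAt (by simp))
      (((hFs.fderiv_right (m := ∞) le_rfl).clm_apply hch).differentiableAt (by simp)),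
      covDeriv_fderiv_field hG hF hq X (hch.differentiableAt (by simp))]
    simp only [map_add, _root_.add_apply]
    rw [metric_covDeriv_normal_tangent hG hF hq X T hII
      (fun q hq v => metric_secondFundamentalForm_tangent hG hF hq Y Z v),
      metric_secondFundamentalForm_tangent hG hF hq,
      hG.symm _ (hF.mapsTo q hq) (secondFundamentalForm G F q X T)]
    simp only [inducedMetric_apply]
    ring
  have h := congrArg (fun w => G (F q) w (fderiv ℝ F q T))
    (covDeriv_comm hG hF hq X Y (contDiffAt_fderiv_apply hFs Z))
  simp only [map_sub, _root_.sub_apply, key, map_smul, _root_.smul_apply, smul_eq_mul,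
    ← inducedMetric_apply] at h
  rw [riemannCurvature, map_sub, _root_.sub_apply]
  linarith

lemma normalDeriv_eq (hG : IsSpaceForm G Γ U c) (hF : IsImmersionOn F W U)
    {q : E} (hq : q ∈ W) (X : E) (ξ : E → V) :
    normalDeriv G F X ξ q = normalProj G F q (covDeriv Γ F X ξ q) := by
  rw [normalDeriv, ambientDeriv_eq hG hF hq]

/-- The Ricci equation, in terms of the shape operator `τ` in the direction `n`. -/
theorem ricci_equation (hG : IsSpaceForm G Γ U c) (hF : IsImmersionOn F W U)
    {q : E} (hq : q ∈ W) {n ν : V} (hn : ∀ v, G (F q) n (fderiv ℝ F q v) = 0)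
    (hν : ∀ v, G (F q) ν (fderiv ℝ F q v) = 0) :
    ∃ τ : E → E, (∀ Y Z, inducedMetric G F q (τ Y) Z
        = - G (F q) (secondFundamentalForm G F q Y Z) n) ∧
      ∀ X Y, G (F q) (normalCurvature G F q X Y n) ν
        = G (F q) (secondFundamentalForm G F q Y (τ X)) ν
          - G (F q) (secondFundamentalForm G F q X (τ Y)) ν := by
  have hFs := hF.smooth q hq
  set ξ : E → V := fun q => normalProj G F q n with hξdef
  have hξq : ξ q = n := normalProj_of_normal hG hF hq hn
  have hξs : ∀ q ∈ W, ContDiffAt ℝ ∞ ξ q := fun q hq =>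
    contDiffAt_normalProj hG hF hq contDiffAt_const
  have hξn : ∀ q ∈ W, ∀ v, G (F q) (ξ q) (fderiv ℝ F q v) = 0 := fun q hq v =>
    metric_normalProj_tangent hG hF hq n v
  -- In the usual sign convention this `τ` is minus the shape operator of `n`: it is the tangential
  -- part of the derivative of the normal extension of `n`.
  refine ⟨fun Y => tangentPart G F q (covDeriv Γ F Y ξ q), fun Y Z => ?_, fun X Y => ?_⟩
  · rw [inducedMetric_tangentPart hG hF hq,
      metric_covDeriv_normal_tangent hG hF hq Y Z (hξs q hq) hξn, hξq]
  have key : ∀ X Y, G (F q) (normalDeriv G F X (normalDeriv G F Y ξ) q) ν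
      = G (F q) (covDeriv Γ F X (covDeriv Γ F Y ξ) q) ν
        - G (F q) (secondFundamentalForm G F q X (tangentPart G F q (covDeriv Γ F Y ξ q))) ν := by
    intro X Y
    have hcs : ContDiffAt ℝ ∞ (covDeriv Γ F Y ξ) q := contDiffAt_covDeriv hG hF hq Y (hξs q hq)
    have hts := contDiffAt_tangentPart hG hF hq hcs
    have hev : (covDeriv Γ F Y ξ) =ᶠ[𝓝 q] fun q => normalDeriv G F Y ξ q
          + fderiv ℝ F q (tangentPart G F q (covDeriv Γ F Y ξ q)) := by
      filter_upwards [hF.isOpen.mem_nhds hq] with q' hq'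
      rw [normalDeriv_eq hG hF hq', ← normalProj_add_tangentPart]
    have hns : ContDiffAt ℝ ∞ (normalDeriv G F Y ξ) q := by
      refine (contDiffAt_normalProj hG hF hq hcs).congr_of_eventuallyEq ?_
      filter_upwards [hF.isOpen.mem_nhds hq] with q' hq'
      rw [normalDeriv_eq hG hF hq']
    rw [normalDeriv_eq hG hF hq, metric_normalProj_normal hG hF hq _ hν, covDeriv_congr hev,
      covDeriv_add (hns.differentiableAt (by simp))
        (((hFs.fderiv_right (m := ∞) le_rfl).clm_apply hts).differentiableAt (by simp)),
      covDeriv_fderiv_field hG hF hq X (hts.differentiableAt (by simp))]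
    simp only [map_add, _root_.add_apply]
    rw [hG.symm _ (hF.mapsTo q hq) (fderiv ℝ F q _) ν,
      hG.symm _ (hF.mapsTo q hq) (fderiv ℝ F q (christoffel _ _ _ _)) ν, hν, hν]
    ring
  -- The ambient curvature term contains only products of `ξ q` with tangent vectors, so it vanishes
  -- and `c` does not enter.
  have h := congrArg (fun w => G (F q) w ν) (covDeriv_comm hG hF hq X Y (hξs q hq))
  have hs := hG.symm _ (hF.mapsTo q hq)
  simp only [map_sub, _root_.sub_apply, map_smul, _root_.smul_apply, smul_eq_mul,
    hs (fderiv ℝ F q _) (ξ q), hξn q hq] at h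
  have h2 : normalCurvature G F q X Y n = normalDeriv G F X (normalDeriv G F Y ξ) q
      - normalDeriv G F Y (normalDeriv G F X ξ) q := rfl
  rw [h2, map_sub, _root_.sub_apply, key, key]
  linarith

end Geometry

/-! ### Orthonormal frames and shape matrices -/

section Frames

lemma eq_sum_of_orthonormal {M ι : Type*} [AddCommGroup M] [Module ℝ M] [FiniteDimensional ℝ M]
    [Fintype ι] [DecidableEq ι] (b : M →ₗ[ℝ] M →ₗ[ℝ] ℝ) {e : ι → M}
    (he : ∀ i j, b (e i) (e j) = if i = j then 1 else 0)
    (hcard : Fintype.card ι = Module.finrank ℝ M) (v : M) : v = ∑ i, b v (e i) • e i := by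
  have hli : LinearIndependent ℝ e := by
    rw [Fintype.linearIndependent_iff]
    intro f hf i
    have := congrArg (fun w => b w (e i)) hf
    simpa [he] using this
  have hv : v ∈ Submodule.span ℝ (Set.range e) := by
    rw [hli.span_eq_top_of_card_eq_finrank' hcard]
    trivial
  obtain ⟨f, rfl⟩ := (Submodule.mem_span_range_iff_exists_fun ℝ).1 hv
  simp [he]

/-- The vector space `M` carries no norm, so that the lemma also applies to the normal space, which
appears below as the kernel of a linear map. -/
lemma exists_orthonormal {M : Type*} [AddCommGroup M] [Module ℝ M] [FiniteDimensional ℝ M]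
    {k : ℕ} (hk : Module.finrank ℝ M = k) (b : M →ₗ[ℝ] M →ₗ[ℝ] ℝ) (hs : ∀ v w, b v w = b w v)
    (hpos : ∀ v, v ≠ 0 → 0 < b v v) :
    ∃ e : Fin k → M, ∀ i j, b (e i) (e j) = if i = j then 1 else 0 := by
  subst hk
  obtain ⟨v, hv⟩ := LinearMap.BilinForm.exists_orthogonal_basis (B := b)
    ⟨fun v w => hs v w⟩
  refine ⟨fun i => (√(b (v i) (v i)))⁻¹ • v i, fun i j => ?_⟩
  have hp : ∀ i, 0 < b (v i) (v i) := fun i => hpos _ (v.ne_zero i)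
  split_ifs with h
  · subst h
    have h1 := Real.mul_self_sqrt (hp i).le
    have h2 := (Real.sqrt_pos.2 (hp i)).ne'
    simp only [map_smul, LinearMap.smul_apply, smul_eq_mul]
    nth_rewrite 3 [← h1]
    field_simp
  · have : b (v i) (v j) = 0 := hv h
    simp [this]

variable {E : Type*} [NormedAddCommGroup E] [NormedSpace ℝ E] [FiniteDimensional ℝ E]
variable {V : Type*} [NormedAddCommGroup V] [NormedSpace ℝ V] [FiniteDimensional ℝ V]
variable {G : MetricField V} {Γ : V → V →L[ℝ] V →L[ℝ] V} {U : Set V} {c : ℝ}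
variable {F : E → V} {W : Set E} {m p : ℕ}

/-- A continuous bilinear form as a bilinear map. -/
noncomputable def bilin (b : E →L[ℝ] E →L[ℝ] ℝ) : E →ₗ[ℝ] E →ₗ[ℝ] ℝ :=
  LinearMap.mk₂ ℝ (fun v w => b v w) (by simp) (by simp) (by simp) (by simp)

lemma bilin_apply (b : E →L[ℝ] E →L[ℝ] ℝ) (v w : E) : bilin b v w = b v w := rfl

lemma eq_sum_of_isOrthonormalFamily {b : E →L[ℝ] E →L[ℝ] ℝ} {e : Fin m → E}
    (he : IsOrthonormalFamily b e) (hm : Module.finrank ℝ E = m) (v : E) :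
    v = ∑ i, b v (e i) • e i :=
  eq_sum_of_orthonormal (bilin b) he (by simp [hm]) v

lemma exists_isOrthonormalFamily (hG : IsSpaceForm G Γ U c) (hF : IsImmersionOn F W U)
    {q : E} (hq : q ∈ W) (hm : Module.finrank ℝ E = m) :
    ∃ e : Fin m → E, IsOrthonormalFamily (inducedMetric G F q) e := by
  obtain ⟨e, he⟩ := exists_orthonormal hm (bilin (inducedMetric G F q))
    (fun v w => by simp only [bilin_apply]; exact inducedMetric_symm hG hF hq v w)
    (fun v hv => by rw [bilin_apply]; exact inducedMetric_pos hG hF hq v hv)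
  exact ⟨e, fun i j => by rw [← he i j, bilin_apply]⟩

/-- The normal space is the kernel of `w ↦ ⟨w, dF ·⟩` from `V` to the dual of `E`. This map is onto
because the induced metric is nondegenerate, so the kernel has dimension `p` by rank and nullity. -/
lemma exists_isNormalFrame (hG : IsSpaceForm G Γ U c) (hF : IsImmersionOn F W U)
    {q : E} (hq : q ∈ W) (hm : Module.finrank ℝ E = m) (hV : Module.finrank ℝ V = m + p) :
    ∃ n : Fin p → V, IsNormalFrame G F q n := by
  set φ : V →ₗ[ℝ] E →ₗ[ℝ] ℝ :=
    (bilin (G (F q))).compl₂ (fderiv ℝ F q).toLinearMap with hφ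
  have hφa : ∀ w v, φ w v = G (F q) w (fderiv ℝ F q v) := fun _ _ => rfl
  have hsurj : Function.Surjective φ := by
    intro α
    refine ⟨fderiv ℝ F q ((inducedMetric G F q).inverse (LinearMap.toContinuousLinearMap α)), ?_⟩
    ext v
    rw [hφa, ← inducedMetric_apply,
      (isInvertible_of_pos (inducedMetric_pos hG hF hq)).self_apply_inverse]
    rfl
  have hfin : Module.finrank ℝ (LinearMap.ker φ) = p := by
    have h1 := φ.finrank_range_add_finrank_ker
    have h2 : Module.finrank ℝ (E →ₗ[ℝ] ℝ) = Module.finrank ℝ E := Subspace.dual_finrank_eq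
    rw [LinearMap.range_eq_top.2 hsurj, finrank_top, h2, hV, hm] at h1
    omega
  obtain ⟨n, hn⟩ := exists_orthonormal hfin
    ((bilin (G (F q))).domRestrict₁₂ (LinearMap.ker φ) (LinearMap.ker φ))
    (fun v w => hG.symm _ (hF.mapsTo q hq) _ _)
    (fun v hv => hG.pos _ (hF.mapsTo q hq) _ fun h => hv (Subtype.ext h))
  refine ⟨fun a => n a, hn, fun a v => ?_⟩
  rw [← hφa, (LinearMap.mem_ker).1 (n a).2]
  rfl

/-- A tangent frame and the normal frame together form an orthonormal basis of `V`, in which the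
tangential coefficients of a normal vector vanish. -/
lemma eq_sum_of_isNormalFrame (hG : IsSpaceForm G Γ U c) (hF : IsImmersionOn F W U)
    {q : E} (hq : q ∈ W) (hm : Module.finrank ℝ E = m) (hV : Module.finrank ℝ V = m + p)
    {n : Fin p → V} (hn : IsNormalFrame G F q n) {w : V}
    (hw : ∀ v, G (F q) w (fderiv ℝ F q v) = 0) : w = ∑ a, G (F q) w (n a) • n a := by
  obtain ⟨e, he⟩ := exists_isOrthonormalFamily hG hF hq hm
  have hs := hG.symm _ (hF.mapsTo q hq)
  have h := eq_sum_of_orthonormal (bilin (G (F q)))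
    (e := Sum.elim (fun i => fderiv ℝ F q (e i)) n) (by
      rintro (i | a) (j | b)
      · simpa [bilin_apply, inducedMetric_apply] using he i j
      · simpa [bilin_apply] using (hs _ _).trans (hn.2 b (e i))
      · simpa [bilin_apply] using hn.2 a (e j)
      · simpa [bilin_apply] using hn.1 a b) (by simp [hV]) w
  have hw' : ∀ v, bilin (G (F q)) w (fderiv ℝ F q v) = 0 := hw
  simp only [Fintype.sum_sum_type, Sum.elim_inl, Sum.elim_inr, hw', zero_smul,
    Finset.sum_const_zero, zero_add] at h
  exact h

lemma metric_normal_eq_sum (hG : IsSpaceForm G Γ U c) (hF : IsImmersionOn F W U)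
    {q : E} (hq : q ∈ W) (hm : Module.finrank ℝ E = m) (hV : Module.finrank ℝ V = m + p)
    {n : Fin p → V} (hn : IsNormalFrame G F q n) (w : V) {w' : V}
    (hw' : ∀ v, G (F q) w' (fderiv ℝ F q v) = 0) :
    G (F q) w w' = ∑ a, G (F q) w (n a) * G (F q) w' (n a) := by
  nth_rewrite 1 [eq_sum_of_isNormalFrame hG hF hq hm hV hn hw']
  simp [mul_comm]

/-- Against a normal vector the projection disappears. The right side is visibly bilinear in `X` and
`Y`, and it is the form in which second fundamental forms are computed below. -/
lemma metric_secondFundamentalForm_eq (hG : IsSpaceForm G Γ U c) (hF : IsImmersionOn F W U)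
    {q : E} (hq : q ∈ W) (X Y : E) {ν : V} (hν : ∀ v, G (F q) ν (fderiv ℝ F q v) = 0) :
    G (F q) (secondFundamentalForm G F q X Y) ν
      = G (F q) (fderiv ℝ (fderiv ℝ F) q X Y + Γ (F q) (fderiv ℝ F q X) (fderiv ℝ F q Y)) ν := by
  rw [metric_secondFundamentalForm_normal hG hF hq X Y hν, covDeriv,
    fderiv_fderiv_apply (hF.smooth q hq)]

lemma metric_secondFundamentalForm_sum (hG : IsSpaceForm G Γ U c) (hF : IsImmersionOn F W U)
    {q : E} (hq : q ∈ W) {ι : Type*} [Fintype ι] (X : E) (f : ι → ℝ) (v : ι → E) {ν : V}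
    (hν : ∀ v, G (F q) ν (fderiv ℝ F q v) = 0) :
    G (F q) (secondFundamentalForm G F q X (∑ k, f k • v k)) ν
      = ∑ k, f k * G (F q) (secondFundamentalForm G F q X (v k)) ν := by
  simp only [metric_secondFundamentalForm_eq hG hF hq _ _ hν, map_sum, map_smul, map_add,
    _root_.sum_apply, _root_.smul_apply, _root_.add_apply, smul_eq_mul, mul_add,
    Finset.sum_add_distrib]

/-- The matrices of the shape operators with respect to frames. -/
noncomputable def shapeMatrix (G : MetricField V) (F : E → V) (q : E) (e : Fin m → E) (n : Fin p → V)
    (a : Fin p) : Matrix (Fin m) (Fin m) ℝ :=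
  Matrix.of fun i j => G (F q) (secondFundamentalForm G F q (e i) (e j)) (n a)

lemma shapeMatrix_apply (q : E) (e : Fin m → E) (n : Fin p → V) (a : Fin p) (i j : Fin m) :
    shapeMatrix G F q e n a i j = G (F q) (secondFundamentalForm G F q (e i) (e j)) (n a) := rfl

lemma shapeMatrix_isSymm (hG : IsSpaceForm G Γ U c) (hF : IsImmersionOn F W U) {q : E}
    (hq : q ∈ W) (e : Fin m → E) (n : Fin p → V) (a : Fin p) :
    (shapeMatrix G F q e n a).IsSymm := by
  ext i j
  rw [Matrix.transpose_apply, shapeMatrix_apply, shapeMatrix_apply,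
    secondFundamentalForm_symm hG hF hq]

/-- This is the Ricci equation with `τ (e i)` expanded in the frame. Only the square of the result
is used, so the sign is immaterial. -/
lemma metric_normalCurvature (hG : IsSpaceForm G Γ U c) (hF : IsImmersionOn F W U) {q : E}
    (hq : q ∈ W) (hm : Module.finrank ℝ E = m) {e : Fin m → E}
    (he : IsOrthonormalFamily (inducedMetric G F q) e)
    {n : Fin p → V} (hn : IsNormalFrame G F q n) (i j : Fin m) (a b : Fin p) :
    G (F q) (normalCurvature G F q (e i) (e j) (n a)) (n b)
      = -⁅shapeMatrix G F q e n a, shapeMatrix G F q e n b⁆ i j := by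
  obtain ⟨τ, h1, h2⟩ := ricci_equation hG hF hq (hn.2 a) (hn.2 b)
  have h3 : ∀ i j, G (F q) (secondFundamentalForm G F q (e j) (τ (e i))) (n b)
      = -(shapeMatrix G F q e n a * shapeMatrix G F q e n b) i j := by
    intro i j
    rw [eq_sum_of_isOrthonormalFamily he hm (τ (e i)),
      metric_secondFundamentalForm_sum hG hF hq _ _ _ (hn.2 b), Matrix.mul_apply,
      ← Finset.sum_neg_distrib]
    refine Finset.sum_congr rfl fun k _ => ?_
    rw [h1, (shapeMatrix_isSymm hG hF hq e n b).apply j k, shapeMatrix_apply, shapeMatrix_apply,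
      neg_mul]
  rw [h2, h3, h3, Ring.lie_def, Matrix.sub_apply]
  have h4 : (shapeMatrix G F q e n a * shapeMatrix G F q e n b) j i
      = (shapeMatrix G F q e n b * shapeMatrix G F q e n a) i j := by
    rw [← Matrix.transpose_apply (shapeMatrix G F q e n a * shapeMatrix G F q e n b),
      Matrix.transpose_mul, (shapeMatrix_isSymm hG hF hq e n a).eq,
      (shapeMatrix_isSymm hG hF hq e n b).eq]
  rw [h4]
  ring

lemma sum_sum_Ioi_eq {g : Fin m → Fin m → ℝ} (hg : ∀ i j, g i j = g j i) (h0 : ∀ i, g i i = 0) :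
    ∑ i, ∑ j ∈ Finset.Ioi i, g i j = (∑ i, ∑ j, g i j) / 2 := by
  rw [sum_sum_eq_of_symm g hg]
  simp [h0]

lemma scalarCurvature_eq (hG : IsSpaceForm G Γ U c) (hF : IsImmersionOn F W U) {q : E}
    (hq : q ∈ W) (hm : Module.finrank ℝ E = m) (hV : Module.finrank ℝ V = m + p) (h2 : 2 ≤ m)
    {e : Fin m → E} (he : IsOrthonormalFamily (inducedMetric G F q) e)
    {n : Fin p → V} (hn : IsNormalFrame G F q n) :
    scalarCurvature (inducedMetric G F) q e = c + (∑ a, (shapeMatrix G F q e n a).trace ^ 2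
      - normSum (shapeMatrix G F q e n)) / ((m : ℝ) * (m - 1)) := by
  have hm2 : (2 : ℝ) ≤ m := by exact_mod_cast h2
  set h := shapeMatrix G F q e n with hh
  have hsy : ∀ a i j, h a i j = h a j i := fun a i j =>
    (shapeMatrix_isSymm hG hF hq e n a).apply j i
  -- The value `0` at `i = j`, which never occurs here, makes the summand vanish on the diagonal, so
  -- that the sum over `i < j` is half of the full double sum.
  have key : ∀ i, ∀ j ∈ Finset.Ioi i,
      inducedMetric G F q (riemannCurvature (inducedMetric G F) q (e i) (e j) (e j)) (e i)
      = (if i = j then 0 else c) + ∑ a, (h a i i * h a j j - h a i j * h a i j) := by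
    intro i j hij
    have hne : i ≠ j := (Finset.mem_Ioi.1 hij).ne
    rw [gauss_equation hG hF hq, he, he, he, he,
      metric_normal_eq_sum hG hF hq hm hV hn _
        (metric_secondFundamentalForm_tangent hG hF hq (e i) (e i)),
      metric_normal_eq_sum hG hF hq hm hV hn _
        (metric_secondFundamentalForm_tangent hG hF hq (e j) (e i)), Finset.sum_sub_distrib]
    simp only [hne, hne.symm, if_true, if_false, ← shapeMatrix_apply]
    rw [add_sub_assoc]
    congr 1
    · ring
    · congr 1
      · exact Finset.sum_congr rfl fun a _ => mul_comm _ _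
      · exact Finset.sum_congr rfl fun a _ => by rw [← hh, hsy a j i]
  have e1 : ∑ i : Fin m, ∑ j ∈ Finset.Ioi i, (if i = j then 0 else c) = c * (m * (m - 1)) / 2 := by
    rw [sum_sum_Ioi_eq (fun i j => by simp only [eq_comm]) (by simp)]
    have : ∀ i j : Fin m, (if i = j then 0 else c) = c - if i = j then c else 0 := by
      intro i j
      split_ifs <;> simp
    simp only [this, Finset.sum_sub_distrib, Finset.sum_ite_eq, Finset.mem_univ, if_true,
      Finset.sum_const, Finset.card_univ, Fintype.card_fin, nsmul_eq_mul]
    ring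
  have e2 : ∑ i, ∑ j ∈ Finset.Ioi i, ∑ a, (h a i i * h a j j - h a i j * h a i j)
      = (∑ a, (h a).trace ^ 2 - normSum h) / 2 := by
    rw [sum_sum_Ioi_eq (g := fun i j => ∑ a, (h a i i * h a j j - h a i j * h a i j))
      (fun i j => Finset.sum_congr rfl fun a _ => by rw [hsy a i j]; ring) (by simp)]
    congr 1
    simp only [Finset.sum_sub_distrib, normSum, frob_eq_sum]
    congr 1
    · rw [Finset.sum_congr rfl fun i _ => Finset.sum_comm, Finset.sum_comm]
      refine Finset.sum_congr rfl fun a _ => ?_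
      rw [Matrix.trace, sq, Finset.sum_mul_sum]
      rfl
    · rw [Finset.sum_congr rfl fun i _ => Finset.sum_comm, Finset.sum_comm]
  rw [scalarCurvature, Finset.sum_congr rfl fun i _ => Finset.sum_congr rfl (key i)]
  simp only [Finset.sum_add_distrib, e1]
  rw [e2]
  have h3 : (m : ℝ) - 1 ≠ 0 := by linarith
  field_simp

lemma metric_meanCurvature {q : E} {e : Fin m → E} {n : Fin p → V} (a : Fin p) :
    G (F q) (meanCurvature G F q e) (n a) = (shapeMatrix G F q e n a).trace / m := by
  simp only [meanCurvature, map_smul, map_sum, _root_.smul_apply, _root_.sum_apply, smul_eq_mul,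
    Matrix.trace, Matrix.diag_apply, shapeMatrix_apply]
  ring

lemma metric_meanCurvature_tangent (hG : IsSpaceForm G Γ U c) (hF : IsImmersionOn F W U) {q : E}
    (hq : q ∈ W) (e : Fin m → E) (v : E) :
    G (F q) (meanCurvature G F q e) (fderiv ℝ F q v) = 0 := by
  simp [meanCurvature, metric_secondFundamentalForm_tangent hG hF hq]

lemma meanCurvature_eq_zero_iff (hG : IsSpaceForm G Γ U c) (hF : IsImmersionOn F W U) {q : E}
    (hq : q ∈ W) (hm : Module.finrank ℝ E = m) (hV : Module.finrank ℝ V = m + p) (h0 : 0 < m)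
    (e : Fin m → E) {n : Fin p → V} (hn : IsNormalFrame G F q n) :
    meanCurvature G F q e = 0 ↔ ∀ a, (shapeMatrix G F q e n a).trace = 0 := by
  have hm0 : (m : ℝ) ≠ 0 := by exact_mod_cast h0.ne'
  constructor
  · intro h a
    have := metric_meanCurvature (G := G) (F := F) (q := q) (e := e) (n := n) a
    rw [h] at this
    rw [map_zero, _root_.zero_apply, eq_comm, div_eq_zero_iff] at this
    exact this.resolve_right hm0
  · intro h
    rw [eq_sum_of_isNormalFrame hG hF hq hm hV hn (metric_meanCurvature_tangent hG hF hq e)]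
    simp [metric_meanCurvature, h]

/-- The full sum `lieSum` counts each pair `i < j` and each pair `a < b` twice, so the root is
halved and cancels the factor `2` of the normalization. -/
lemma normalScalarCurvature_eq (hG : IsSpaceForm G Γ U c) (hF : IsImmersionOn F W U) {q : E}
    (hq : q ∈ W) (hm : Module.finrank ℝ E = m) {e : Fin m → E}
    (he : IsOrthonormalFamily (inducedMetric G F q) e)
    {n : Fin p → V} (hn : IsNormalFrame G F q n) :
    normalScalarCurvature G F q e n
      = √(lieSum (shapeMatrix G F q e n)) / ((m : ℝ) * (m - 1)) := by
  set h := shapeMatrix G F q e n with hh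
  have h1 : ∀ a b, ∀ i j, ⁅h a, h b⁆ i j = -⁅h b, h a⁆ i j := fun a b i j => by
    simp [Ring.lie_def]
  have h2 : ∀ a b, ∀ i j, ⁅h a, h b⁆ i j = -⁅h a, h b⁆ j i := fun a b i j => by
    have hs := fun a => (shapeMatrix_isSymm hG hF hq e n a).eq
    rw [← Matrix.transpose_apply ⁅h a, h b⁆, Ring.lie_def, Matrix.transpose_sub,
      Matrix.transpose_mul, Matrix.transpose_mul, hs, hs]
    simp [hh]
  have e1 : ∑ i, ∑ j ∈ Finset.Ioi i, ∑ a, ∑ b ∈ Finset.Ioi a,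
      (G (F q) (normalCurvature G F q (e i) (e j) (n a)) (n b)) ^ 2 = lieSum h / 4 := by
    simp only [metric_normalCurvature hG hF hq hm he hn, neg_sq, ← hh]
    have e2 : ∀ i j, ∑ a, ∑ b ∈ Finset.Ioi a, ⁅h a, h b⁆ i j ^ 2
        = (∑ a, ∑ b, ⁅h a, h b⁆ i j ^ 2) / 2 := fun i j =>
      sum_sum_Ioi_eq (fun a b => by rw [h1, neg_sq]) (fun a => by simp [Ring.lie_def])
    simp only [e2]
    rw [sum_sum_Ioi_eq (fun i j => by
      congr 1
      exact Finset.sum_congr rfl fun a _ => Finset.sum_congr rfl fun b _ => by rw [h2, neg_sq])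
      (fun i => by
        have : ∀ a b, ⁅h a, h b⁆ i i = 0 := fun a b => by linarith [h2 a b i i]
        simp [this])]
    simp only [← Finset.sum_div]
    rw [div_div, show (2 : ℝ) * 2 = 4 by norm_num]
    rw [lieSum]
    congr 1
    simp only [frob_eq_sum, sq]
    rw [Finset.sum_congr rfl fun i _ => Finset.sum_comm, Finset.sum_comm]
    refine Finset.sum_congr rfl fun a _ => ?_
    rw [Finset.sum_congr rfl fun i _ => Finset.sum_comm, Finset.sum_comm]
  rw [normalScalarCurvature, e1]
  have : √(lieSum h / 4) = √(lieSum h) / 2 := by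
    rw [Real.sqrt_div' _ (by norm_num), show (4 : ℝ) = 2 ^ 2 by norm_num,
      Real.sqrt_sq (by norm_num)]
  rw [this]
  ring

/-- Equality in the DDVV inequality in terms of the shape operators. -/
theorem ddvv_equality_iff (hG : IsSpaceForm G Γ U c) (hF : IsImmersionOn F W U) {q : E}
    (hq : q ∈ W) (hm : Module.finrank ℝ E = m) (hV : Module.finrank ℝ V = m + p) (h2 : 2 ≤ m)
    {e : Fin m → E} (he : IsOrthonormalFamily (inducedMetric G F q) e)
    {n : Fin p → V} (hn : IsNormalFrame G F q n) :
    scalarCurvature (inducedMetric G F) q e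
      = c + G (F q) (meanCurvature G F q e) (meanCurvature G F q e)
          - normalScalarCurvature G F q e n ↔ WintgenEq (shapeMatrix G F q e n) := by
  have hm2 : (2 : ℝ) ≤ m := by exact_mod_cast h2
  have h3 : (0 : ℝ) < m - 1 := by linarith
  rw [scalarCurvature_eq hG hF hq hm hV h2 he hn, normalScalarCurvature_eq hG hF hq hm he hn,
    metric_normal_eq_sum hG hF hq hm hV hn _ (metric_meanCurvature_tangent hG hF hq e)]
  simp only [metric_meanCurvature, WintgenEq, Fintype.card_fin]
  set h := shapeMatrix G F q e n
  have e1 : ∑ a, (h a).trace / m * ((h a).trace / m) = (∑ a, (h a).trace ^ 2) / (m : ℝ) ^ 2 := by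
    rw [Finset.sum_div]
    exact Finset.sum_congr rfl fun a _ => by ring
  have e2 : ∑ a, (frob (h a) (h a) - (h a).trace ^ 2 / m)
      = normSum h - (∑ a, (h a).trace ^ 2) / m := by
    rw [Finset.sum_sub_distrib, Finset.sum_div, normSum]
  rw [e1, e2]
  set T := ∑ a, (h a).trace ^ 2
  set N := normSum h
  set L := √(lieSum h)
  -- In the difference of the two sides `c` cancels, and the trace terms combine because `1 / (m (m
  -- - 1)) - 1 / m² = 1 / (m² (m - 1))`.
  have e3 : c + (T - N) / (m * (m - 1)) - (c + T / (m : ℝ) ^ 2 - L / (m * (m - 1)))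
      = -(N - T / m - L) / (m * (m - 1)) := by
    field_simp
    ring
  rw [← sub_eq_zero, e3, div_eq_zero_iff, neg_eq_zero, sub_eq_zero]
  have : (m : ℝ) * (m - 1) ≠ 0 := by positivity
  simp [this]

end Frames

/-! ### Independence of the tangent frame -/

section FrameChange

variable {E : Type*} [NormedAddCommGroup E] [NormedSpace ℝ E] [FiniteDimensional ℝ E]
variable {V : Type*} [NormedAddCommGroup V] [NormedSpace ℝ V] [FiniteDimensional ℝ V]
variable {G : MetricField V} {Γ : V → V →L[ℝ] V →L[ℝ] V} {U : Set V} {c : ℝ}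
variable {F : E → V} {W : Set E} {m p : ℕ}

/-- Two orthonormal tangent frames differ by an orthogonal matrix, which conjugates all shape
matrices simultaneously. -/
lemma wintgenEq_shapeMatrix_congr (hG : IsSpaceForm G Γ U c) (hF : IsImmersionOn F W U) {q : E}
    (hq : q ∈ W) (hm : Module.finrank ℝ E = m) {e e' : Fin m → E}
    (he : IsOrthonormalFamily (inducedMetric G F q) e)
    (he' : IsOrthonormalFamily (inducedMetric G F q) e')
    {n : Fin p → V} (hn : IsNormalFrame G F q n) :
    WintgenEq (shapeMatrix G F q e' n) ↔ WintgenEq (shapeMatrix G F q e n) := by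
  set P : Matrix (Fin m) (Fin m) ℝ := Matrix.of fun i j => inducedMetric G F q (e' j) (e i) with hP
  have hexp : ∀ j, e' j = ∑ i, P i j • e i := fun j =>
    eq_sum_of_isOrthonormalFamily he hm (e' j)
  have h1 : P.transpose * P = 1 := by
    ext j k
    have := congrArg (inducedMetric G F q (e' j)) (hexp k)
    rw [he' j k, map_sum] at this
    rw [Matrix.mul_apply, Matrix.one_apply, this]
    refine Finset.sum_congr rfl fun i _ => ?_
    rw [map_smul, smul_eq_mul, mul_comm]
    rfl
  have h2 : ∀ a, shapeMatrix G F q e' n a = P.transpose * shapeMatrix G F q e n a * P := by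
    intro a
    ext i j
    rw [shapeMatrix_apply, hexp j, metric_secondFundamentalForm_sum hG hF hq _ _ _ (hn.2 a),
      Matrix.mul_apply]
    refine Finset.sum_congr rfl fun k _ => ?_
    rw [secondFundamentalForm_symm hG hF hq, hexp i,
      metric_secondFundamentalForm_sum hG hF hq _ _ _ (hn.2 a), Matrix.mul_apply, mul_comm]
    congr 1
    refine Finset.sum_congr rfl fun l _ => ?_
    rw [secondFundamentalForm_symm hG hF hq]
    rfl
  have h3 : shapeMatrix G F q e' n = fun a => P.transpose * shapeMatrix G F q e n a * P :=
    funext h2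
  rw [h3, wintgenEq_conj (mul_eq_one_comm.1 h1)]

end FrameChange

/-! ### Euclidean space and hyperbolic half-space as space forms -/

section Models

variable {V : Type*} [NormedAddCommGroup V] [InnerProductSpace ℝ V]

/-- The flat metric of an inner product space. -/
noncomputable def flatMetric (V : Type*) [NormedAddCommGroup V] [InnerProductSpace ℝ V] :
    MetricField V := fun _ => innerSL ℝ

lemma flatMetric_apply (y v w : V) : flatMetric V y v w = inner ℝ v w := rfl

lemma isSpaceForm_flat : IsSpaceForm (flatMetric V) (fun _ => 0) Set.univ 0 where
  isOpen := isOpen_univ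
  smooth _ _ := contDiffAt_const
  symm _ _ v w := real_inner_comm _ _
  pos _ _ _ hv := real_inner_self_pos.2 hv
  conn_smooth _ _ := contDiffAt_const
  conn_symm _ _ _ _ := rfl
  compat y _ v w z := by
    have : fderiv ℝ (flatMetric V) y = 0 := by
      unfold flatMetric
      simp
    simp [this]
  curv y _ X Y Z := by simp

/-- The half-space metric `⟪η, y⟫⁻² ⟪·, ·⟫` determined by the unit vector `η`. -/
noncomputable def halfSpaceMetric (η : V) : MetricField V :=
  fun y => ((inner ℝ η y) ^ 2)⁻¹ • innerSL ℝ

lemma halfSpaceMetric_apply (η y v w : V) :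
    halfSpaceMetric η y v w = ((inner ℝ η y) ^ 2)⁻¹ * inner ℝ v w := rfl

/-- The bilinear map `(v, w) ↦ ⟪η, v⟫ w + ⟪η, w⟫ v - ⟪v, w⟫ η`. -/
noncomputable def halfSpaceBilin (η : V) : V →L[ℝ] V →L[ℝ] V :=
  (innerSL ℝ η).smulRight (ContinuousLinearMap.id ℝ V)
    + ((innerSL ℝ η).smulRight (ContinuousLinearMap.id ℝ V)).flip
    - (ContinuousLinearMap.smulRightL ℝ V V).flip η ∘L innerSL ℝ

lemma halfSpaceBilin_apply (η v w : V) :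
    halfSpaceBilin η v w = (inner ℝ η v : ℝ) • w + (inner ℝ η w : ℝ) • v
      - (inner ℝ v w : ℝ) • η := by
  simp only [halfSpaceBilin, _root_.sub_apply, _root_.add_apply, ContinuousLinearMap.smulRight_apply,
    ContinuousLinearMap.flip_apply, ContinuousLinearMap.comp_apply,
    ContinuousLinearMap.smulRightL_apply_apply, innerSL_apply_apply, _root_.smul_apply,
    ContinuousLinearMap.id_apply]
  rfl

/-- The symbols of the Levi-Civita connection of the half-space metric. -/
noncomputable def halfSpaceConn (η : V) : V → V →L[ℝ] V →L[ℝ] V :=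
  fun y => -(inner ℝ η y : ℝ)⁻¹ • halfSpaceBilin η

lemma hasFDerivAt_inner_left (η y : V) :
    HasFDerivAt (fun y => (inner ℝ η y : ℝ)) (innerSL ℝ η) y :=
  (innerSL ℝ η).hasFDerivAt

lemma hasFDerivAt_smul_const {T : Type*} [NormedAddCommGroup T] [NormedSpace ℝ T] {f : V → ℝ}
    {f' : V →L[ℝ] ℝ} {y : V} (h : HasFDerivAt f f' y) (B : T) :
    HasFDerivAt (fun y => f y • B) (f'.smulRight B) y :=
  h.smul_const B

lemma contDiffAt_smul_const {T : Type*} [NormedAddCommGroup T] [NormedSpace ℝ T] {f : V → ℝ}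
    {y : V} (h : ContDiffAt ℝ ∞ f y) (B : T) : ContDiffAt ℝ ∞ (fun y => f y • B) y :=
  h.smul contDiffAt_const

/-- The metric is conformally flat with factor `exp (2ρ)`, `ρ = -log ⟪η, y⟫`, and the symbols are
those of the conformal change formula. The norm of `η` enters only in the curvature, where `⟪η, η⟫ =
1` fixes the value `-1`. -/
lemma isSpaceForm_halfSpace {η : V} (hη : inner ℝ η η = (1 : ℝ)) :
    IsSpaceForm (halfSpaceMetric η) (halfSpaceConn η) {y | 0 < (inner ℝ η y : ℝ)} (-1) where
  isOpen := isOpen_lt continuous_const (by fun_prop)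
  smooth y hy := by
    have hy' : (inner ℝ η y : ℝ) ^ 2 ≠ 0 := pow_ne_zero 2 (ne_of_gt hy)
    exact contDiffAt_smul_const (((innerSL ℝ η).contDiff.contDiffAt.pow 2).inv hy') _
  symm y _ v w := by
    rw [halfSpaceMetric_apply, halfSpaceMetric_apply, real_inner_comm v w]
  pos y hy v hv := by
    rw [halfSpaceMetric_apply]
    have hy' : 0 < (inner ℝ η y : ℝ) := hy
    have := real_inner_self_pos.2 hv
    positivity
  conn_smooth y hy :=
    contDiffAt_smul_const (((innerSL ℝ η).contDiff.contDiffAt.inv (ne_of_gt hy)).neg) _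
  conn_symm y _ v w := by
    simp only [halfSpaceConn, _root_.smul_apply, halfSpaceBilin_apply]
    rw [real_inner_comm v w, add_comm ((inner ℝ η v : ℝ) • w)]
  compat y hy v w z := by
    have hy' : (inner ℝ η y : ℝ) ≠ 0 := ne_of_gt hy
    have h := hasFDerivAt_smul_const (((hasDerivAt_pow 2 (inner ℝ η y : ℝ)).inv
      (pow_ne_zero 2 hy')).comp_hasFDerivAt y (hasFDerivAt_inner_left η y))
      (innerSL ℝ : V →L[ℝ] V →L[ℝ] ℝ)
    have h' : fderiv ℝ (halfSpaceMetric η) y = _ := h.fderiv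
    rw [h']
    change (-(((2 : ℕ) : ℝ) * inner ℝ η y ^ (2 - 1)) / (inner ℝ η y ^ 2) ^ 2 * inner ℝ η v)
      * inner ℝ w z = _
    simp only [halfSpaceMetric_apply, halfSpaceConn, _root_.smul_apply, halfSpaceBilin_apply,
      inner_smul_left, inner_smul_right, inner_add_left, inner_add_right, inner_sub_left,
      inner_sub_right, RCLike.conj_to_real]
    rw [real_inner_comm v w, real_inner_comm η w]
    field_simp
    push_cast
    ring
  curv y hy X Y Z := by
    have hy' : (inner ℝ η y : ℝ) ≠ 0 := ne_of_gt hy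
    have h := hasFDerivAt_smul_const (((hasDerivAt_inv hy').neg).comp_hasFDerivAt y
      (hasFDerivAt_inner_left η y)) (halfSpaceBilin η)
    have h' : fderiv ℝ (halfSpaceConn η) y = _ := h.fderiv
    rw [h']
    simp only [halfSpaceMetric_apply, halfSpaceConn, _root_.smul_apply, halfSpaceBilin_apply,
      ContinuousLinearMap.smulRight_apply, smul_eq_mul, innerSL_apply_apply, inner_smul_right,
      inner_add_right, inner_sub_right, hη]
    rw [real_inner_comm η X, real_inner_comm η Y, real_inner_comm X Y]
    have h2 : ((inner ℝ η y : ℝ) ^ 2)⁻¹ = (inner ℝ η y : ℝ)⁻¹ * (inner ℝ η y : ℝ)⁻¹ := by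
      rw [sq, mul_inv]
    rw [h2]
    module

end Models

/-! ### First and second derivatives of the rotational map -/

section Rotational

variable {E₁ : Type*} [NormedAddCommGroup E₁] [NormedSpace ℝ E₁]
variable {E₂ : Type*} [NormedAddCommGroup E₂] [NormedSpace ℝ E₂]
variable {V₁ : Type*} [NormedAddCommGroup V₁] [InnerProductSpace ℝ V₁]
variable {V₂ : Type*} [NormedAddCommGroup V₂] [InnerProductSpace ℝ V₂]
variable {V : Type*} [NormedAddCommGroup V] [InnerProductSpace ℝ V]

/-- `A` is the orthogonal projection along the unit vector `η` followed by an isometry, and `B` is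
an isometry onto a space orthogonal to the image of `A`. -/
structure IsRotationalSplitting (η : V₁) (A : V₁ →L[ℝ] V) (B : V₂ →L[ℝ] V) : Prop where
  unit : inner ℝ η η = (1 : ℝ)
  inner_left : ∀ x y, (inner ℝ (A x) (A y) : ℝ) = inner ℝ x y - inner ℝ η x * inner ℝ η y
  inner_right : ∀ x y, (inner ℝ (B x) (B y) : ℝ) = inner ℝ x y
  inner_left_right : ∀ x y, (inner ℝ (A x) (B y) : ℝ) = 0

/-- The rotational submanifold over `u`, in terms of a splitting of the ambient space. -/
noncomputable def rotMap (η : V₁) (A : V₁ →L[ℝ] V) (B : V₂ →L[ℝ] V) (u : E₁ → V₁) (φ : E₂ → V₂)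
    (z : E₁ × E₂) : V :=
  A (u z.1) + (inner ℝ η (u z.1) : ℝ) • B (φ z.2)

/-- The isometry from the ambient space of `u` that maps normal vectors to normal vectors. -/
noncomputable def rotLift (η : V₁) (A : V₁ →L[ℝ] V) (B : V₂ →L[ℝ] V) (w : V₂) (ν : V₁) : V :=
  A ν + (inner ℝ η ν : ℝ) • B w

variable {η : V₁} {A : V₁ →L[ℝ] V} {B : V₂ →L[ℝ] V} {u : E₁ → V₁} {φ : E₂ → V₂}
variable {W₁ : Set E₁} {W₂ : Set E₂}

lemma IsRotationalSplitting.inner_right_left (h : IsRotationalSplitting η A B) (x : V₁) (y : V₂) :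
    (inner ℝ (B y) (A x) : ℝ) = 0 := by
  rw [real_inner_comm, h.inner_left_right]

lemma rotLift_sum {ι : Type*} [Fintype ι] (w : V₂) (f : ι → ℝ) (ν : ι → V₁) :
    rotLift η A B w (∑ a, f a • ν a) = ∑ a, f a • rotLift η A B w (ν a) := by
  simp only [rotLift, map_sum, map_smul, inner_sum, inner_smul_right, Finset.sum_smul, smul_add,
    Finset.sum_add_distrib, mul_smul]

/-- The map `A` loses exactly the component along `η`, and the unit vector `B w`, orthogonal to the
image of `A`, restores it. -/
lemma inner_rotLift (h : IsRotationalSplitting η A B) {w : V₂} (hw : inner ℝ w w = (1 : ℝ))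
    (ν μ : V₁) : (inner ℝ (rotLift η A B w ν) (rotLift η A B w μ) : ℝ) = inner ℝ ν μ := by
  simp only [rotLift, inner_add_left, inner_add_right, inner_smul_left, inner_smul_right,
    h.inner_left, h.inner_right, h.inner_left_right, h.inner_right_left, hw, RCLike.conj_to_real]
  ring

lemma hasFDerivAt_smul_right {ξ : E₁ → V₁} {ψ : E₂ → V₂} {s : E₁} {t : E₂}
    (hξ : DifferentiableAt ℝ ξ s) (hψ : DifferentiableAt ℝ ψ t) :
    ∃ D : E₁ × E₂ →L[ℝ] V,
      HasFDerivAt (fun z : E₁ × E₂ => (inner ℝ η (ξ z.1) : ℝ) • B (ψ z.2)) D (s, t) ∧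
      ∀ X X', D (X, X') = (inner ℝ η (fderiv ℝ ξ s X) : ℝ) • B (ψ t)
        + (inner ℝ η (ξ s) : ℝ) • B (fderiv ℝ ψ t X') := by
  have h1 : HasFDerivAt (fun z : E₁ × E₂ => ξ z.1)
      (fderiv ℝ ξ s ∘L ContinuousLinearMap.fst ℝ E₁ E₂) (s, t) :=
    hξ.hasFDerivAt.comp (s, t) hasFDerivAt_fst
  have h2 : HasFDerivAt (fun z : E₁ × E₂ => ψ z.2)
      (fderiv ℝ ψ t ∘L ContinuousLinearMap.snd ℝ E₁ E₂) (s, t) :=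
    hψ.hasFDerivAt.comp (s, t) hasFDerivAt_snd
  have h3 := (innerSL ℝ η).hasFDerivAt.comp (s, t) h1
  have h4 := B.hasFDerivAt.comp (s, t) h2
  refine ⟨_, h3.smul h4, fun X X' => ?_⟩
  simp [add_comm]

lemma hasFDerivAt_left {ξ : E₁ → V₁} {s : E₁} (t : E₂) (hξ : DifferentiableAt ℝ ξ s) :
    HasFDerivAt (fun z : E₁ × E₂ => A (ξ z.1))
      (A ∘L fderiv ℝ ξ s ∘L ContinuousLinearMap.fst ℝ E₁ E₂) (s, t) :=
  A.hasFDerivAt.comp (s, t) (hξ.hasFDerivAt.comp (s, t) hasFDerivAt_fst)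

/-- The derivative is `rotLift` of `du X` along `φ t`, plus `⟪η, u⟫` times the image of `dφ X'`. The
lift therefore carries normal vectors of `u` to normal vectors of the rotational map. -/
lemma fderiv_rotMap {s : E₁} {t : E₂} (hu : DifferentiableAt ℝ u s)
    (hφ : DifferentiableAt ℝ φ t) (X : E₁) (X' : E₂) :
    fderiv ℝ (rotMap η A B u φ) (s, t) (X, X')
      = A (fderiv ℝ u s X) + ((inner ℝ η (fderiv ℝ u s X) : ℝ) • B (φ t)
        + (inner ℝ η (u s) : ℝ) • B (fderiv ℝ φ t X')) := by
  obtain ⟨D, hD, h⟩ := hasFDerivAt_smul_right (η := η) (B := B) hu hφ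
  have h1 : fderiv ℝ (rotMap η A B u φ) (s, t) = _ := ((hasFDerivAt_left t hu).add hD).fderiv
  rw [h1, ← h]
  rfl

section Immersions

variable {U₁ : Set V₁} {U₂ : Set V₂}

lemma contDiffAt_rotMap (hu : IsImmersionOn u W₁ U₁) (hφ : IsImmersionOn φ W₂ U₂) {s : E₁}
    (hs : s ∈ W₁) {t : E₂} (ht : t ∈ W₂) : ContDiffAt ℝ ∞ (rotMap η A B u φ) (s, t) := by
  have h1 : ContDiffAt ℝ ∞ (fun z : E₁ × E₂ => u z.1) (s, t) :=
    ContDiffAt.comp (g := u) (s, t) (hu.smooth s hs) contDiffAt_fst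
  have h2 : ContDiffAt ℝ ∞ (fun z : E₁ × E₂ => φ z.2) (s, t) :=
    ContDiffAt.comp (g := φ) (s, t) (hφ.smooth t ht) contDiffAt_snd
  exact (A.contDiff.contDiffAt.comp (s, t) h1).add
    (((innerSL ℝ η).contDiff.contDiffAt.comp (s, t) h1).smul
      (B.contDiff.contDiffAt.comp (s, t) h2))

lemma fderiv_fderiv_rotMap (hu : IsImmersionOn u W₁ U₁) (hφ : IsImmersionOn φ W₂ U₂) {s : E₁}
    (hs : s ∈ W₁) {t : E₂} (ht : t ∈ W₂) (X Y : E₁) (X' Y' : E₂) :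
    fderiv ℝ (fderiv ℝ (rotMap η A B u φ)) (s, t) (X, X') (Y, Y')
      = A (fderiv ℝ (fderiv ℝ u) s X Y)
        + ((inner ℝ η (fderiv ℝ (fderiv ℝ u) s X Y) : ℝ) • B (φ t)
          + (inner ℝ η (fderiv ℝ u s Y) : ℝ) • B (fderiv ℝ φ t X'))
        + ((inner ℝ η (fderiv ℝ u s X) : ℝ) • B (fderiv ℝ φ t Y')
          + (inner ℝ η (u s) : ℝ) • B (fderiv ℝ (fderiv ℝ φ) t X' Y')) := by
  have hd : ∀ s ∈ W₁, DifferentiableAt ℝ u s := fun s hs =>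
    (hu.smooth s hs).differentiableAt (by simp)
  have hd' : ∀ t ∈ W₂, DifferentiableAt ℝ φ t := fun t ht =>
    (hφ.smooth t ht).differentiableAt (by simp)
  have hev : (fun z => fderiv ℝ (rotMap η A B u φ) z (Y, Y')) =ᶠ[𝓝 (s, t)] fun z =>
      (A (fderiv ℝ u z.1 Y) + (inner ℝ η (fderiv ℝ u z.1 Y) : ℝ) • B (φ z.2))
        + (inner ℝ η (u z.1) : ℝ) • B (fderiv ℝ φ z.2 Y') := by
    filter_upwards [(hu.isOpen.prod hφ.isOpen).mem_nhds (Set.mk_mem_prod hs ht)] with z hz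
    rw [show z = (z.1, z.2) from rfl, fderiv_rotMap (hd _ hz.1) (hd' _ hz.2), add_assoc]
  have hdu := (contDiffAt_fderiv_apply (hu.smooth s hs) Y).differentiableAt (by simp)
  have hdφ := (contDiffAt_fderiv_apply (hφ.smooth t ht) Y').differentiableAt (by simp)
  obtain ⟨D, hD, h⟩ := hasFDerivAt_smul_right (η := η) (B := B) hdu (hd' t ht)
  obtain ⟨D', hD', h'⟩ := hasFDerivAt_smul_right (η := η) (B := B) (hd s hs) hdφ
  have hsum : fderiv ℝ (fun z : E₁ × E₂ =>
      (A (fderiv ℝ u z.1 Y) + (inner ℝ η (fderiv ℝ u z.1 Y) : ℝ) • B (φ z.2))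
        + (inner ℝ η (u z.1) : ℝ) • B (fderiv ℝ φ z.2 Y')) (s, t) = _ :=
    (((hasFDerivAt_left t hdu).add hD).add hD').fderiv
  rw [← fderiv_fderiv_apply (contDiffAt_rotMap hu hφ hs ht), hev.fderiv_eq, hsum]
  simp only [_root_.add_apply, h, h', ContinuousLinearMap.comp_apply,
    ContinuousLinearMap.coe_fst', fderiv_fderiv_apply (hu.smooth s hs),
    fderiv_fderiv_apply (hφ.smooth t ht)]


lemma inner_fderiv_of_unit (hφ : IsImmersionOn φ W₂ Set.univ)
    (hφ1 : ∀ t ∈ W₂, inner ℝ (φ t) (φ t) = (1 : ℝ)) {t : E₂} (ht : t ∈ W₂) (X : E₂) :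
    (inner ℝ (φ t) (fderiv ℝ φ t X) : ℝ) = 0 := by
  have hd := (hφ.smooth t ht).differentiableAt (by simp)
  have h1 := fderiv_metric_apply isSpaceForm_flat hφ ht hd hd X
  have h2 : (fun t => flatMetric V₂ (φ t) (φ t) (φ t)) =ᶠ[𝓝 t] fun _ => 1 := by
    filter_upwards [hφ.isOpen.mem_nhds ht] with t ht using hφ1 t ht
  rw [h2.fderiv_eq] at h1
  simp only [fderiv_fun_const, Pi.zero_apply, _root_.zero_apply, covDeriv, flatMetric_apply,
    add_zero] at h1
  rw [real_inner_comm (φ t)] at h1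
  linarith

/-- The position vector of a map into the unit sphere is normal to it, and differentiating this
orthogonality gives the identity. -/
lemma inner_fderiv_fderiv_of_unit [FiniteDimensional ℝ E₂] [FiniteDimensional ℝ V₂]
    (hφ : IsImmersionOn φ W₂ Set.univ)
    (hφ1 : ∀ t ∈ W₂, inner ℝ (φ t) (φ t) = (1 : ℝ)) {t : E₂} (ht : t ∈ W₂) (X Y : E₂) :
    (inner ℝ (φ t) (fderiv ℝ (fderiv ℝ φ) t X Y) : ℝ)
      = - inner ℝ (fderiv ℝ φ t X) (fderiv ℝ φ t Y) := by
  have hn : ∀ t ∈ W₂, ∀ v, flatMetric V₂ (φ t) (φ t) (fderiv ℝ φ t v) = 0 := fun t ht v =>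
    inner_fderiv_of_unit hφ hφ1 ht v
  have h1 := metric_covDeriv_normal_tangent isSpaceForm_flat hφ ht X Y (hφ.smooth t ht) hn
  rw [metric_secondFundamentalForm_eq isSpaceForm_flat hφ ht X Y (hn t ht)] at h1
  simp only [covDeriv, flatMetric_apply, _root_.zero_apply, add_zero] at h1
  rw [real_inner_comm]
  linarith

/-- The induced metric is a warped product. Dividing by `⟪η, u⟫ ^ 2` gives the product of the
half-space metric of `u` and the metric of `φ`, which is why hyperbolic geometry appears. -/
lemma inner_fderiv_rotMap (h : IsRotationalSplitting η A B)
    (hφ1 : ∀ t ∈ W₂, inner ℝ (φ t) (φ t) = (1 : ℝ)) (hu : IsImmersionOn u W₁ U₁)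
    (hφ : IsImmersionOn φ W₂ Set.univ) {s : E₁} (hs : s ∈ W₁) {t : E₂} (ht : t ∈ W₂)
    (X Y : E₁) (X' Y' : E₂) :
    (inner ℝ (fderiv ℝ (rotMap η A B u φ) (s, t) (X, X'))
        (fderiv ℝ (rotMap η A B u φ) (s, t) (Y, Y')) : ℝ)
      = inner ℝ (fderiv ℝ u s X) (fderiv ℝ u s Y)
        + inner ℝ η (u s) ^ 2 * inner ℝ (fderiv ℝ φ t X') (fderiv ℝ φ t Y') := by
  have h1 := fun X => inner_fderiv_of_unit hφ hφ1 ht X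
  have h2 := fun X => (real_inner_comm _ _).trans (h1 X)
  rw [fderiv_rotMap ((hu.smooth s hs).differentiableAt (by simp))
    ((hφ.smooth t ht).differentiableAt (by simp)),
    fderiv_rotMap ((hu.smooth s hs).differentiableAt (by simp))
    ((hφ.smooth t ht).differentiableAt (by simp))]
  simp only [inner_add_left, inner_add_right, inner_smul_left, inner_smul_right,
    h.inner_left, h.inner_right, h.inner_left_right, h.inner_right_left, hφ1 t ht,
    RCLike.conj_to_real, h1, h2]
  ring

lemma inner_rotLift_fderiv_rotMap (h : IsRotationalSplitting η A B)
    (hφ1 : ∀ t ∈ W₂, inner ℝ (φ t) (φ t) = (1 : ℝ)) (hu : IsImmersionOn u W₁ U₁)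
    (hφ : IsImmersionOn φ W₂ Set.univ) {s : E₁} (hs : s ∈ W₁) {t : E₂} (ht : t ∈ W₂)
    (ν : V₁) (X : E₁) (X' : E₂) :
    (inner ℝ (rotLift η A B (φ t) ν) (fderiv ℝ (rotMap η A B u φ) (s, t) (X, X')) : ℝ)
      = inner ℝ ν (fderiv ℝ u s X) := by
  have h1 := fun X => inner_fderiv_of_unit hφ hφ1 ht X
  rw [fderiv_rotMap ((hu.smooth s hs).differentiableAt (by simp))
    ((hφ.smooth t ht).differentiableAt (by simp)), rotLift]
  simp only [inner_add_left, inner_add_right, inner_smul_left, inner_smul_right,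
    h.inner_left, h.inner_right, h.inner_left_right, h.inner_right_left, hφ1 t ht,
    RCLike.conj_to_real, h1]
  ring

/-- Mixed terms point along `B (dφ)`, which is orthogonal to the lift since `dφ ⊥ φ`. In the sphere
directions only the component of the second derivative of `φ` along `φ` survives. -/
lemma inner_fderiv_fderiv_rotMap_rotLift [FiniteDimensional ℝ E₂] [FiniteDimensional ℝ V₂]
    (h : IsRotationalSplitting η A B)
    (hφ1 : ∀ t ∈ W₂, inner ℝ (φ t) (φ t) = (1 : ℝ)) (hu : IsImmersionOn u W₁ U₁)
    (hφ : IsImmersionOn φ W₂ Set.univ) {s : E₁} (hs : s ∈ W₁) {t : E₂} (ht : t ∈ W₂)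
    (ν : V₁) (X Y : E₁) (X' Y' : E₂) :
    (inner ℝ (fderiv ℝ (fderiv ℝ (rotMap η A B u φ)) (s, t) (X, X') (Y, Y'))
        (rotLift η A B (φ t) ν) : ℝ)
      = inner ℝ (fderiv ℝ (fderiv ℝ u) s X Y) ν
        - inner ℝ η (u s) * inner ℝ η ν * inner ℝ (fderiv ℝ φ t X') (fderiv ℝ φ t Y') := by
  have h1 := fun X => inner_fderiv_of_unit hφ hφ1 ht X
  have h2 := fun X => (real_inner_comm _ _).trans (h1 X)
  have h3 : (inner ℝ (fderiv ℝ (fderiv ℝ φ) t X' Y') (φ t) : ℝ) = _ :=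
    (real_inner_comm _ _).trans (inner_fderiv_fderiv_of_unit hφ hφ1 ht X' Y')
  rw [fderiv_fderiv_rotMap hu hφ hs ht, rotLift]
  simp only [inner_add_left, inner_add_right, inner_smul_left, inner_smul_right,
    h.inner_left, h.inner_right, h.inner_left_right, h.inner_right_left, hφ1 t ht,
    RCLike.conj_to_real, h2, h3]
  ring

lemma isImmersionOn_rotMap (h : IsRotationalSplitting η A B)
    (hφ1 : ∀ t ∈ W₂, inner ℝ (φ t) (φ t) = (1 : ℝ))
    (hu : IsImmersionOn u W₁ {y | 0 < (inner ℝ η y : ℝ)}) (hφ : IsImmersionOn φ W₂ Set.univ) :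
    IsImmersionOn (rotMap η A B u φ) (W₁ ×ˢ W₂) Set.univ where
  isOpen := hu.isOpen.prod hφ.isOpen
  smooth := fun ⟨_, _⟩ hz => contDiffAt_rotMap hu hφ hz.1 hz.2
  mapsTo _ _ := trivial
  inj := by
    rintro ⟨s, t⟩ hz
    refine (injective_iff_map_eq_zero _).2 ?_
    rintro ⟨X, X'⟩ h0
    have hpos : 0 < (inner ℝ η (u s) : ℝ) := hu.mapsTo s hz.1
    have h1 := inner_fderiv_rotMap h hφ1 hu hφ hz.1 hz.2 X X X' X'
    rw [h0, inner_zero_left] at h1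
    have h2 : (0 : ℝ) ≤ inner ℝ (fderiv ℝ u s X) (fderiv ℝ u s X) := real_inner_self_nonneg
    have h3 : (0 : ℝ) ≤ inner ℝ (fderiv ℝ φ t X') (fderiv ℝ φ t X') := real_inner_self_nonneg
    have h4 : (inner ℝ (fderiv ℝ u s X) (fderiv ℝ u s X) : ℝ) = 0 := by
      nlinarith [mul_nonneg (sq_nonneg (inner ℝ η (u s) : ℝ)) h3]
    have h5 : (inner ℝ (fderiv ℝ φ t X') (fderiv ℝ φ t X') : ℝ) = 0 := by
      rw [h4, zero_add, zero_eq_mul] at h1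
      exact h1.resolve_left (by positivity)
    have h6 := hu.inj s hz.1 ((inner_self_eq_zero.1 h4).trans (map_zero _).symm)
    have h7 := hφ.inj t hz.2 ((inner_self_eq_zero.1 h5).trans (map_zero _).symm)
    rw [h6, h7]
    rfl

end Immersions

end Rotational

/-! ### Shape matrices of the rotational submanifold -/

section RotationalFrames

variable {E₁ : Type*} [NormedAddCommGroup E₁] [NormedSpace ℝ E₁] [FiniteDimensional ℝ E₁]
variable {E₂ : Type*} [NormedAddCommGroup E₂] [NormedSpace ℝ E₂] [FiniteDimensional ℝ E₂]
variable {V₁ : Type*} [NormedAddCommGroup V₁] [InnerProductSpace ℝ V₁] [FiniteDimensional ℝ V₁]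
variable {V₂ : Type*} [NormedAddCommGroup V₂] [InnerProductSpace ℝ V₂] [FiniteDimensional ℝ V₂]
variable {V : Type*} [NormedAddCommGroup V] [InnerProductSpace ℝ V] [FiniteDimensional ℝ V]
variable {η : V₁} {A : V₁ →L[ℝ] V} {B : V₂ →L[ℝ] V} {u : E₁ → V₁} {φ : E₂ → V₂}
variable {W₁ : Set E₁} {W₂ : Set E₂} {r k m p : ℕ}

/-- Of the three terms of the connection only the one along `η` has a normal component. Up to scale,
the hyperbolic form is the Euclidean one plus a multiple of the first fundamental form. -/
lemma halfSpaceMetric_secondFundamentalForm (hη : inner ℝ η η = (1 : ℝ))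
    (hu : IsImmersionOn u W₁ {y | 0 < (inner ℝ η y : ℝ)}) {s : E₁} (hs : s ∈ W₁) (X Y : E₁)
    {ν : V₁} (hν : ∀ v, halfSpaceMetric η (u s) ν (fderiv ℝ u s v) = 0) :
    halfSpaceMetric η (u s) (secondFundamentalForm (halfSpaceMetric η) u s X Y) ν
      = (inner ℝ η (u s) : ℝ)⁻¹ ^ 2 * (inner ℝ (fderiv ℝ (fderiv ℝ u) s X Y) ν
        + (inner ℝ η (u s) : ℝ)⁻¹ * inner ℝ (fderiv ℝ u s X) (fderiv ℝ u s Y) * inner ℝ η ν) := by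
  have hpos : 0 < (inner ℝ η (u s) : ℝ) := hu.mapsTo s hs
  have hν' : ∀ v, (inner ℝ (fderiv ℝ u s v) ν : ℝ) = 0 := by
    intro v
    have := hν v
    rw [halfSpaceMetric_apply, mul_eq_zero] at this
    rw [real_inner_comm]
    exact this.resolve_left (by positivity)
  rw [metric_secondFundamentalForm_eq (isSpaceForm_halfSpace hη) hu hs X Y hν,
    halfSpaceMetric_apply, halfSpaceConn, _root_.smul_apply, _root_.smul_apply,
    halfSpaceBilin_apply]
  simp only [inner_add_left, inner_sub_left, inner_smul_left, hν', RCLike.conj_to_real]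
  rw [inv_pow]
  ring

/-- The frame of a rotational submanifold built from frames of its two factors. -/
def rotFrame (a : ℝ) (e : Fin r → E₁) (θ : Fin k → E₂) (σ : Fin m ≃ Fin r ⊕ Fin k)
    (i : Fin m) : E₁ × E₂ :=
  Sum.elim (fun i => (a • e i, 0)) (fun j => (0, a • θ j)) (σ i)

lemma isOrthonormalFamily_rotFrame (h : IsRotationalSplitting η A B)
    (hφ1 : ∀ t ∈ W₂, inner ℝ (φ t) (φ t) = (1 : ℝ))
    (hu : IsImmersionOn u W₁ {y | 0 < (inner ℝ η y : ℝ)})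
    (hφ : IsImmersionOn φ W₂ Set.univ) {s : E₁} (hs : s ∈ W₁) {t : E₂} (ht : t ∈ W₂)
    {e : Fin r → E₁} (he : IsOrthonormalFamily (inducedMetric (halfSpaceMetric η) u s) e)
    {θ : Fin k → E₂} (hθ : IsOrthonormalFamily (inducedMetric (flatMetric V₂) φ t) θ)
    (σ : Fin m ≃ Fin r ⊕ Fin k) :
    IsOrthonormalFamily (inducedMetric (flatMetric V) (rotMap η A B u φ) (s, t))
      (rotFrame (inner ℝ η (u s) : ℝ)⁻¹ e θ σ) := by
  have hpos : 0 < (inner ℝ η (u s) : ℝ) := hu.mapsTo s hs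
  have he' : ∀ i j, ((inner ℝ η (u s) : ℝ) ^ 2)⁻¹ * inner ℝ (fderiv ℝ u s (e i))
      (fderiv ℝ u s (e j)) = if i = j then (1 : ℝ) else 0 := he
  have hθ' : ∀ i j, inner ℝ (fderiv ℝ φ t (θ i)) (fderiv ℝ φ t (θ j))
      = if i = j then (1 : ℝ) else 0 := hθ
  intro i j
  rw [inducedMetric_apply, flatMetric_apply, rotFrame, rotFrame]
  have hij : (if i = j then (1 : ℝ) else 0) = if σ i = σ j then 1 else 0 := by simp
  rw [hij]
  rcases σ i with i | i <;> rcases σ j with j | j <;>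
    simp only [Sum.elim_inl, Sum.elim_inr, inner_fderiv_rotMap h hφ1 hu hφ hs ht, map_smul,
      inner_smul_left, inner_smul_right, map_zero, inner_zero_left, inner_zero_right, hθ',
      RCLike.conj_to_real, Sum.inl.injEq, Sum.inr.injEq, reduceCtorEq, if_false]
  · rw [← he' i j]
    field_simp
    ring
  · ring
  · ring
  · split_ifs
    · field_simp
      ring
    · ring

lemma isNormalFrame_rotLift (h : IsRotationalSplitting η A B)
    (hφ1 : ∀ t ∈ W₂, inner ℝ (φ t) (φ t) = (1 : ℝ))
    (hu : IsImmersionOn u W₁ {y | 0 < (inner ℝ η y : ℝ)})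
    (hφ : IsImmersionOn φ W₂ Set.univ) {s : E₁} (hs : s ∈ W₁) {t : E₂} (ht : t ∈ W₂)
    {n : Fin p → V₁} (hn : IsNormalFrame (halfSpaceMetric η) u s n) :
    IsNormalFrame (flatMetric V) (rotMap η A B u φ) (s, t)
      (fun b => rotLift η A B (φ t) ((inner ℝ η (u s) : ℝ)⁻¹ • n b)) := by
  have hpos : 0 < (inner ℝ η (u s) : ℝ) := hu.mapsTo s hs
  refine ⟨fun i j => ?_, ?_⟩
  · have := hn.1 i j
    rw [halfSpaceMetric_apply] at this
    rw [flatMetric_apply, inner_rotLift h (hφ1 t ht), inner_smul_left, inner_smul_right, ← this,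
      RCLike.conj_to_real]
    field_simp
  · rintro b ⟨X, X'⟩
    have := hn.2 b X
    rw [halfSpaceMetric_apply, mul_eq_zero] at this
    rw [flatMetric_apply, inner_rotLift_fderiv_rotMap h hφ1 hu hφ hs ht, inner_smul_left,
      this.resolve_left (by positivity), mul_zero]

/-- Write `a = ⟪η, u⟫⁻¹` and `h` for the hyperbolic shape matrix. The block of `M` is `a ^ 3 *
⟪∂ᵢ∂ⱼu, n b⟫ = a * h i j - a ^ 2 * ⟪η, n b⟫ * δ`, where the correction is the conformal term; the
sphere block is `-a ^ 2 * ⟪η, n b⟫ * δ`. The common scalar matrix splits off. -/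
lemma shapeMatrix_rotMap (h : IsRotationalSplitting η A B)
    (hφ1 : ∀ t ∈ W₂, inner ℝ (φ t) (φ t) = (1 : ℝ))
    (hu : IsImmersionOn u W₁ {y | 0 < (inner ℝ η y : ℝ)})
    (hφ : IsImmersionOn φ W₂ Set.univ) {s : E₁} (hs : s ∈ W₁) {t : E₂} (ht : t ∈ W₂)
    {e : Fin r → E₁} (he : IsOrthonormalFamily (inducedMetric (halfSpaceMetric η) u s) e)
    {θ : Fin k → E₂} (hθ : IsOrthonormalFamily (inducedMetric (flatMetric V₂) φ t) θ)
    {n : Fin p → V₁} (hn : IsNormalFrame (halfSpaceMetric η) u s n)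
    (σ : Fin m ≃ Fin r ⊕ Fin k) (b : Fin p) :
    shapeMatrix (flatMetric V) (rotMap η A B u φ) (s, t)
        (rotFrame (inner ℝ η (u s) : ℝ)⁻¹ e θ σ)
        (fun b => rotLift η A B (φ t) ((inner ℝ η (u s) : ℝ)⁻¹ • n b)) b
      = (Matrix.fromBlocks
          ((inner ℝ η (u s) : ℝ)⁻¹ • shapeMatrix (halfSpaceMetric η) u s e n b) 0 0 0
          + (-((inner ℝ η (u s) : ℝ)⁻¹ ^ 2 * inner ℝ η (n b)))
            • (1 : Matrix (Fin r ⊕ Fin k) (Fin r ⊕ Fin k) ℝ)).submatrix σ σ := by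
  have hpos : 0 < (inner ℝ η (u s) : ℝ) := hu.mapsTo s hs
  have he' : ∀ i j, ((inner ℝ η (u s) : ℝ) ^ 2)⁻¹ * inner ℝ (fderiv ℝ u s (e i))
      (fderiv ℝ u s (e j)) = if i = j then (1 : ℝ) else 0 := he
  have hθ' : ∀ i j, inner ℝ (fderiv ℝ φ t (θ i)) (fderiv ℝ φ t (θ j))
      = if i = j then (1 : ℝ) else 0 := hθ
  have hN := isNormalFrame_rotLift h hφ1 hu hφ hs ht hn
  ext i j
  rw [shapeMatrix_apply, metric_secondFundamentalForm_eq isSpaceForm_flat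
    (isImmersionOn_rotMap h hφ1 hu hφ) (Set.mk_mem_prod hs ht) _ _ (hN.2 b),
    Matrix.submatrix_apply, flatMetric_apply, _root_.zero_apply, _root_.zero_apply, add_zero,
    rotFrame, rotFrame, Matrix.add_apply, Matrix.smul_apply, Matrix.one_apply]
  rcases σ i with i | i <;> rcases σ j with j | j <;>
    simp only [Sum.elim_inl, Sum.elim_inr, inner_fderiv_fderiv_rotMap_rotLift h hφ1 hu hφ hs ht,
      map_smul, inner_smul_left, inner_smul_right, map_zero, inner_zero_left, inner_zero_right,
      hθ', RCLike.conj_to_real, Sum.inl.injEq, Sum.inr.injEq, reduceCtorEq, if_false,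
      Matrix.fromBlocks_apply₁₁, Matrix.fromBlocks_apply₁₂, Matrix.fromBlocks_apply₂₁,
      Matrix.fromBlocks_apply₂₂, Matrix.smul_apply, Matrix.zero_apply, shapeMatrix_apply,
      halfSpaceMetric_secondFundamentalForm h.unit hu hs _ _ (hn.2 b),
      _root_.smul_apply, _root_.zero_apply, smul_eq_mul]
  · rw [← he' i j]
    field_simp
    ring
  · ring
  · ring
  · split_ifs
    · field_simp
      ring
    · ring

/-- The pointwise correspondence for rotational submanifolds. -/
theorem ddvvEquality_rotMap_iff (h : IsRotationalSplitting η A B)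
    (hφ1 : ∀ t ∈ W₂, inner ℝ (φ t) (φ t) = (1 : ℝ))
    (hu : IsImmersionOn u W₁ {y | 0 < (inner ℝ η y : ℝ)})
    (hφ : IsImmersionOn φ W₂ Set.univ) {s : E₁} (hs : s ∈ W₁) {t : E₂} (ht : t ∈ W₂)
    (hr : 2 ≤ r) (hk : 0 < k) (hm : m = r + k)
    (hE₁ : Module.finrank ℝ E₁ = r) (hE₂ : Module.finrank ℝ E₂ = k)
    (hV₁ : Module.finrank ℝ V₁ = r + p) (hV : Module.finrank ℝ V = m + p) :
    DDVVEquality (flatMetric V) 0 m p (rotMap η A B u φ) (s, t) ↔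
      MeanCurvatureVanishes (halfSpaceMetric η) r u s ∧
        DDVVEquality (halfSpaceMetric η) (-1) r p u s := by
  have hpos : 0 < (inner ℝ η (u s) : ℝ) := hu.mapsTo s hs
  have hH := isSpaceForm_halfSpace h.unit
  have hF := isImmersionOn_rotMap h hφ1 hu hφ
  have hst : (s, t) ∈ W₁ ×ˢ W₂ := Set.mk_mem_prod hs ht
  have hE : Module.finrank ℝ (E₁ × E₂) = m := by
    rw [Module.finrank_prod, hE₁, hE₂, hm]
  have hm2 : 2 ≤ m := by omega
  obtain ⟨θ, hθ⟩ := exists_isOrthonormalFamily isSpaceForm_flat hφ ht hE₂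
  have σ : Fin m ≃ Fin r ⊕ Fin k := (finCongr hm).trans finSumFinEquiv.symm
  have key : ∀ (e : Fin r → E₁) (n : Fin p → V₁),
      IsOrthonormalFamily (inducedMetric (halfSpaceMetric η) u s) e →
      IsNormalFrame (halfSpaceMetric η) u s n →
      (WintgenEq (shapeMatrix (flatMetric V) (rotMap η A B u φ) (s, t)
        (rotFrame (inner ℝ η (u s) : ℝ)⁻¹ e θ σ)
        (fun b => rotLift η A B (φ t) ((inner ℝ η (u s) : ℝ)⁻¹ • n b))) ↔
        meanCurvature (halfSpaceMetric η) u s e = 0 ∧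
          WintgenEq (shapeMatrix (halfSpaceMetric η) u s e n)) := by
    intro e n he hn
    rw [funext (shapeMatrix_rotMap h hφ1 hu hφ hs ht he hθ hn σ), wintgenEq_submatrix σ,
      wintgenEq_fromBlocks_iff (by omega) hk _ (shapeMatrix_isSymm hH hu hs e n)
        (inv_ne_zero hpos.ne'),
      meanCurvature_eq_zero_iff hH hu hs hE₁ hV₁ (by omega) e hn]
  constructor
  · intro hD
    have hboth : ∀ (e : Fin r → E₁) (n : Fin p → V₁),
        IsOrthonormalFamily (inducedMetric (halfSpaceMetric η) u s) e →
        IsNormalFrame (halfSpaceMetric η) u s n →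
        meanCurvature (halfSpaceMetric η) u s e = 0 ∧
          WintgenEq (shapeMatrix (halfSpaceMetric η) u s e n) := by
      intro e n he hn
      have he' := isOrthonormalFamily_rotFrame h hφ1 hu hφ hs ht he hθ σ
      have hn' := isNormalFrame_rotLift h hφ1 hu hφ hs ht hn
      rw [← key e n he hn, ← ddvv_equality_iff isSpaceForm_flat hF hst hE hV hm2 he' hn']
      exact hD _ _ he' hn'
    -- Vanishing mean curvature is a statement about tangent frames alone, so some normal frame has
    -- to be supplied to extract it.
    obtain ⟨n, hn⟩ := exists_isNormalFrame hH hu hs hE₁ hV₁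
    refine ⟨fun e he => (hboth e n he hn).1, fun e n he hn => ?_⟩
    rw [ddvv_equality_iff hH hu hs hE₁ hV₁ hr he hn]
    exact (hboth e n he hn).2
  · rintro ⟨hM, hD⟩ e' n' he' hn'
    obtain ⟨e, he⟩ := exists_isOrthonormalFamily hH hu hs hE₁
    obtain ⟨n₀, hn₀⟩ := exists_isNormalFrame hH hu hs hE₁ hV₁
    have hN₀ := isNormalFrame_rotLift h hφ1 hu hφ hs ht hn₀
    set a := (inner ℝ η (u s) : ℝ) with ha
    -- Every normal frame of the rotational submanifold is lifted from one of `u`: it is expanded in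
    -- the lift of `n₀`, and the same coefficients are applied to `n₀`.
    set f : Fin p → Fin p → ℝ := fun b c =>
      flatMetric V (rotMap η A B u φ (s, t)) (n' b) (rotLift η A B (φ t) (a⁻¹ • n₀ c)) with hf
    set n : Fin p → V₁ := fun b => ∑ c, f b c • n₀ c with hndef
    have hlift : ∀ b, rotLift η A B (φ t) (a⁻¹ • n b) = n' b := by
      intro b
      rw [eq_sum_of_isNormalFrame isSpaceForm_flat hF hst hE hV hN₀ (hn'.2 b), hndef,
        Finset.smul_sum]
      simp only [smul_comm a⁻¹ (f b _), rotLift_sum]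
      rfl
    have hn : IsNormalFrame (halfSpaceMetric η) u s n := by
      refine ⟨fun b c => ?_, fun b v => ?_⟩
      · rw [← hn'.1 b c, flatMetric_apply, ← hlift, ← hlift, inner_rotLift h (hφ1 t ht),
          inner_smul_left, inner_smul_right, halfSpaceMetric_apply, RCLike.conj_to_real, ← ha]
        field_simp
      · simp only [hndef, map_sum, map_smul, _root_.sum_apply, _root_.smul_apply, hn₀.2,
          smul_zero, Finset.sum_const_zero]
    have he₀ := isOrthonormalFamily_rotFrame h hφ1 hu hφ hs ht he hθ σ
    -- The tangent frame `e'` is arbitrary and need not respect the product, so it is exchanged for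
    -- the adapted frame; the normal frame is already a lift.
    rw [ddvv_equality_iff isSpaceForm_flat hF hst hE hV hm2 he' hn',
      wintgenEq_shapeMatrix_congr isSpaceForm_flat hF hst hE he₀ he' hn',
      show n' = fun b => rotLift η A B (φ t) (a⁻¹ • n b) from (funext hlift).symm,
      key e n he hn, ← ddvv_equality_iff hH hu hs hE₁ hV₁ hr he hn]
    exact ⟨hM e he, hD e n he hn⟩

end RotationalFrames

/-! ### From manifolds to local parametrizations -/

section Parametrization

variable {E : Type*} [NormedAddCommGroup E] [NormedSpace ℝ E]
variable {H : Type*} [TopologicalSpace H] {I : ModelWithCorners ℝ E H} [I.Boundaryless]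
variable {N : Type*} [TopologicalSpace N] [ChartedSpace H N]
variable {V : Type*} [NormedAddCommGroup V] [NormedSpace ℝ V]

lemma mfderiv_eq_fderiv_localParam {f : N → V} (hf : ContMDiff I 𝓘(ℝ, V) ∞ f) (x : N) :
    (mfderiv I 𝓘(ℝ, V) f x : E → V) = fderiv ℝ (localParam I f x) (extChartAt I x x) := by
  have h1 : MDifferentiableAt I 𝓘(ℝ, V) f x := (hf x).mdifferentiableAt (by simp)
  rw [h1.mfderiv, I.range_eq_univ, fderivWithin_univ]
  rfl

lemma contDiffAt_localParam [IsManifold I ∞ N] {f : N → V} (hf : ContMDiff I 𝓘(ℝ, V) ∞ f) (x : N)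
    {q : E} (hq : q ∈ (extChartAt I x).target) : ContDiffAt ℝ ∞ (localParam I f x) q := by
  have h1 : ContMDiffOn 𝓘(ℝ, E) 𝓘(ℝ, V) ∞ (localParam I f x) (extChartAt I x).target :=
    hf.comp_contMDiffOn (contMDiffOn_extChartAt_symm x)
  exact h1.contDiffOn.contDiffAt ((isOpen_extChartAt_target x).mem_nhds hq)

/-- Injectivity of the derivative holds at the centre of the chart and is an open condition, so it
persists on a neighbourhood inside the chart target. -/
lemma exists_isImmersionOn_localParam [FiniteDimensional ℝ E] [IsManifold I ∞ N] {f : N → V}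
    (hf : IsSmoothImmersion I f) {U : Set V} (hU : ∀ x, f x ∈ U) (x : N) :
    ∃ W : Set E, extChartAt I x x ∈ W ∧ W ⊆ (extChartAt I x).target ∧
      IsImmersionOn (localParam I f x) W U := by
  have hc : ContinuousOn (fderiv ℝ (localParam I f x)) (extChartAt I x).target := fun q hq =>
    ((contDiffAt_localParam hf.1 x hq).fderiv_right (m := ∞)
      le_rfl).continuousAt.continuousWithinAt
  refine ⟨(extChartAt I x).target ∩
    fderiv ℝ (localParam I f x) ⁻¹' {L | Function.Injective L}, ⟨mem_extChartAt_target x, ?_⟩,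
    Set.inter_subset_left, ?_, fun q hq => contDiffAt_localParam hf.1 x hq.1,
    fun q _ => hU _, fun q hq => hq.2⟩
  · change Function.Injective (fderiv ℝ (localParam I f x) (extChartAt I x x))
    rw [← mfderiv_eq_fderiv_localParam hf.1]
    exact hf.2 x
  · exact hc.isOpen_inter_preimage (isOpen_extChartAt_target x)
      ContinuousLinearMap.isOpen_injective

end Parametrization

/-! ### The coordinate splitting behind `rotational` -/

section Splitting

lemma sum_fin_eq_add {a b n : ℕ} (h : a + b = n) (f : Fin n → ℝ) :
    ∑ i, f i = ∑ j : Fin a, f ⟨j, by omega⟩ + ∑ k : Fin b, f ⟨a + k, by omega⟩ := by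
  subst h
  exact Fin.sum_univ_add f

variable {r p m : ℕ}

/-- The linear map that drops the last coordinate and pads with zeros. -/
noncomputable def dropLast (hr : 0 < r + p) :
    EuclideanSpace ℝ (Fin (r + p)) →L[ℝ] EuclideanSpace ℝ (Fin (m + p)) :=
  LinearMap.toContinuousLinearMap
    { toFun := fun x => WithLp.toLp 2 fun i =>
        if h : (i : ℕ) < r + p - 1 then x ⟨i, by omega⟩ else 0
      map_add' := fun x y => by
        ext i
        by_cases h : (i : ℕ) < r + p - 1 <;> simp [h]
      map_smul' := fun c x => by
        ext i
        by_cases h : (i : ℕ) < r + p - 1 <;> simp [h] }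

/-- The linear map that puts a vector in the last coordinates. -/
noncomputable def padLeft (hr : 0 < r + p) (hrm : r < m) :
    EuclideanSpace ℝ (Fin (m - r + 1)) →L[ℝ] EuclideanSpace ℝ (Fin (m + p)) :=
  LinearMap.toContinuousLinearMap
    { toFun := fun w => WithLp.toLp 2 fun i =>
        if h : (i : ℕ) < r + p - 1 then 0 else w ⟨i - (r + p - 1), by omega⟩
      map_add' := fun x y => by
        ext i
        by_cases h : (i : ℕ) < r + p - 1 <;> simp [h]
      map_smul' := fun c x => by
        ext i
        by_cases h : (i : ℕ) < r + p - 1 <;> simp [h] }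

lemma dropLast_apply (hr : 0 < r + p) (x : EuclideanSpace ℝ (Fin (r + p))) (i : Fin (m + p)) :
    dropLast hr x i = if h : (i : ℕ) < r + p - 1 then x ⟨i, by omega⟩ else 0 := rfl

lemma padLeft_apply (hr : 0 < r + p) (hrm : r < m) (w : EuclideanSpace ℝ (Fin (m - r + 1)))
    (i : Fin (m + p)) : padLeft hr hrm w i
      = if h : (i : ℕ) < r + p - 1 then 0 else w ⟨i - (r + p - 1), by omega⟩ := rfl

/-- The last vector of the standard basis. -/
noncomputable def lastVector (n : ℕ) (hn : 0 < n) : EuclideanSpace ℝ (Fin n) :=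
  EuclideanSpace.single (lastIndex n hn) 1

lemma inner_lastVector (n : ℕ) (hn : 0 < n) (y : EuclideanSpace ℝ (Fin n)) :
    (inner ℝ (lastVector n hn) y : ℝ) = y (lastIndex n hn) := by
  simp [lastVector, EuclideanSpace.inner_single_left]

lemma isRotationalSplitting_padLeft (hr : 0 < r + p) (hrm : r < m) :
    IsRotationalSplitting (lastVector (r + p) hr) (dropLast hr) (padLeft (p := p) hr hrm) where
  unit := by rw [inner_lastVector]; simp [lastVector]
  inner_left x y := by
    rw [inner_lastVector, inner_lastVector, PiLp.inner_apply, PiLp.inner_apply,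
      -- Both sums are cut after the first `r + p - 1` coordinates: the target keeps `m - r + 1`
      -- padded ones, the source only its last one, which is the `η` component.
      sum_fin_eq_add (show r + p - 1 + (m - r + 1) = m + p by omega),
      sum_fin_eq_add (show r + p - 1 + 1 = r + p by omega)]
    simp [dropLast_apply, lastIndex, mul_comm]
  inner_right x y := by
    rw [PiLp.inner_apply, PiLp.inner_apply,
      sum_fin_eq_add (show r + p - 1 + (m - r + 1) = m + p by omega)]
    simp [padLeft_apply]
  inner_left_right x y := by
    rw [PiLp.inner_apply]
    refine Finset.sum_eq_zero fun i _ => ?_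
    by_cases h : (i : ℕ) < r + p - 1 <;> simp [dropLast_apply, padLeft_apply, h]

lemma rotational_eq {M : Type*} (hr : 0 < r + p) (hrm : r < m)
    (u : M → EuclideanSpace ℝ (Fin (r + p)))
    (z : M × Metric.sphere (0 : EuclideanSpace ℝ (Fin (m - r + 1))) 1) :
    rotational hr hrm u z = dropLast hr (u z.1)
      + (inner ℝ (lastVector (r + p) hr) (u z.1) : ℝ) • padLeft hr hrm z.2 := by
  ext i
  rw [inner_lastVector]
  by_cases h : (i : ℕ) < r + p - 1 <;>
    simp [rotational, dropLast_apply, padLeft_apply, h]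

lemma hyperbolicMetric_eq (n : ℕ) (hn : 0 < n) :
    hyperbolicMetric n hn = halfSpaceMetric (lastVector n hn) := by
  funext y
  rw [hyperbolicMetric, halfSpaceMetric, inner_lastVector]

end Splitting

/-! ### The sphere factor -/

section Sphere

lemma isSmoothImmersion_coe_sphere (k : ℕ) :
    IsSmoothImmersion (𝓡 k)
      (Subtype.val : Metric.sphere (0 : EuclideanSpace ℝ (Fin (k + 1))) 1 →
        EuclideanSpace ℝ (Fin (k + 1))) :=
  have := Fact.mk (@finrank_euclideanSpace_fin ℝ _ (k + 1))
  ⟨contMDiff_coe_sphere, injective_mvfderiv_subtypeVal_sphere⟩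

end Sphere

/-! ### Assembling local data on `M × 𝕊` -/

section Final

variable {r m p : ℕ} {M : Type*} [TopologicalSpace M] [ChartedSpace (EuclideanSpace ℝ (Fin r)) M]

/-- The preferred chart of a product is the product of the charts, so the local parametrization of
`f` is a rotational map over those of `u` and of the sphere inclusion. -/
lemma localParam_rotational (hr : 0 < r + p) (hrm : r < m)
    (u : M → EuclideanSpace ℝ (Fin (r + p)))
    (z : M × Metric.sphere (0 : EuclideanSpace ℝ (Fin (m - r + 1))) 1) :
    localParam ((𝓡 r).prod (𝓡 (m - r))) (rotational hr hrm u :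
        M × Metric.sphere (0 : EuclideanSpace ℝ (Fin (m - r + 1))) 1 →
          EuclideanSpace ℝ (Fin (m + p))) z
      = rotMap (lastVector (r + p) hr) (dropLast hr) (padLeft hr hrm)
          (localParam (𝓡 r) u z.1) (localParam (𝓡 (m - r)) Subtype.val z.2) := by
  funext q
  rw [localParam, Function.comp_apply, rotational_eq, extChartAt_prod]
  rfl

/-- Local data at a point of the rotational submanifold. -/
lemma exists_local_immersions [IsManifold (𝓡 r) ∞ M] (hr : 0 < r + p)
    (u : M → EuclideanSpace ℝ (Fin (r + p))) (hu : IsSmoothImmersion (𝓡 r) u)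
    (hpos : ∀ x, u x ∈ upperHalfSpace (r + p) hr)
    (z : M × Metric.sphere (0 : EuclideanSpace ℝ (Fin (m - r + 1))) 1) :
    ∃ (W₁ : Set (EuclideanSpace ℝ (Fin r))) (W₂ : Set (EuclideanSpace ℝ (Fin (m - r)))),
      extChartAt (𝓡 r) z.1 z.1 ∈ W₁ ∧ extChartAt (𝓡 (m - r)) z.2 z.2 ∈ W₂ ∧
      IsImmersionOn (localParam (𝓡 r) u z.1) W₁
        {y | 0 < (inner ℝ (lastVector (r + p) hr) y : ℝ)} ∧
      IsImmersionOn (localParam (𝓡 (m - r)) Subtype.val z.2 :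
        _ → EuclideanSpace ℝ (Fin (m - r + 1))) W₂ Set.univ ∧
      ∀ t ∈ W₂, (inner ℝ (localParam (𝓡 (m - r)) Subtype.val z.2 t :
        EuclideanSpace ℝ (Fin (m - r + 1))) (localParam (𝓡 (m - r)) Subtype.val z.2 t) : ℝ) = 1 := by
  obtain ⟨W₁, h1, -, h2⟩ := exists_isImmersionOn_localParam hu
    (U := {y | 0 < (inner ℝ (lastVector (r + p) hr) y : ℝ)})
    (fun x => by
      change 0 < (inner ℝ (lastVector (r + p) hr) (u x) : ℝ)
      rw [inner_lastVector]
      exact hpos x) z.1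
  obtain ⟨W₂, h3, -, h4⟩ := exists_isImmersionOn_localParam
    (isSmoothImmersion_coe_sphere (m - r)) (U := Set.univ) (fun _ => trivial) z.2
  refine ⟨W₁, W₂, h1, h3, h2, h4, fun t _ => ?_⟩
  rw [localParam, Function.comp_apply, real_inner_self_eq_norm_sq, norm_eq_of_mem_sphere]
  norm_num

lemma extChartAt_rotational (z : M × Metric.sphere (0 : EuclideanSpace ℝ (Fin (m - r + 1))) 1) :
    extChartAt ((𝓡 r).prod (𝓡 (m - r))) z z
      = (extChartAt (𝓡 r) z.1 z.1, extChartAt (𝓡 (m - r)) z.2 z.2) := by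
  rw [extChartAt_prod]
  rfl

/-- This supplies the immersion part of `IsWintgenIdeal` for `f`; injectivity of the differential is
inherited from the warped product metric in the charts. -/
lemma isSmoothImmersion_rotational [IsManifold (𝓡 r) ∞ M] (hr : 0 < r + p) (hrm : r < m)
    (u : M → EuclideanSpace ℝ (Fin (r + p))) (hu : IsSmoothImmersion (𝓡 r) u)
    (hpos : ∀ x, u x ∈ upperHalfSpace (r + p) hr) :
    IsSmoothImmersion ((𝓡 r).prod (𝓡 (m - r))) (rotational hr hrm u :
        M × Metric.sphere (0 : EuclideanSpace ℝ (Fin (m - r + 1))) 1 →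
          EuclideanSpace ℝ (Fin (m + p))) := by
  have hsm : ContMDiff ((𝓡 r).prod (𝓡 (m - r))) 𝓘(ℝ, EuclideanSpace ℝ (Fin (m + p))) ∞
      (rotational hr hrm u :
        M × Metric.sphere (0 : EuclideanSpace ℝ (Fin (m - r + 1))) 1 →
          EuclideanSpace ℝ (Fin (m + p))) := by
    rw [show (rotational hr hrm u :
        M × Metric.sphere (0 : EuclideanSpace ℝ (Fin (m - r + 1))) 1 →
          EuclideanSpace ℝ (Fin (m + p))) = _ from funext (rotational_eq hr hrm u)]
    have h1 : ContMDiff ((𝓡 r).prod (𝓡 (m - r))) 𝓘(ℝ, EuclideanSpace ℝ (Fin (r + p))) ∞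
        (fun z : M × Metric.sphere (0 : EuclideanSpace ℝ (Fin (m - r + 1))) 1 => u z.1) :=
      hu.1.comp contMDiff_fst
    have h2 : ContMDiff ((𝓡 r).prod (𝓡 (m - r))) 𝓘(ℝ, EuclideanSpace ℝ (Fin (m - r + 1))) ∞
        (fun z : M × Metric.sphere (0 : EuclideanSpace ℝ (Fin (m - r + 1))) 1 =>
          (z.2 : EuclideanSpace ℝ (Fin (m - r + 1)))) :=
      (isSmoothImmersion_coe_sphere (m - r)).1.comp contMDiff_snd
    exact ((dropLast hr).contMDiff.comp h1).add
      (((innerSL ℝ (lastVector (r + p) hr)).contMDiff.comp h1).smul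
        ((padLeft hr hrm).contMDiff.comp h2))
  refine ⟨hsm, fun z => ?_⟩
  obtain ⟨W₁, W₂, h1, h2, h3, h4, h5⟩ := exists_local_immersions (m := m) hr u hu hpos z
  have h6 := (isImmersionOn_rotMap (isRotationalSplitting_padLeft hr hrm) h5 h3 h4).inj _
    (Set.mk_mem_prod h1 h2)
  rw [← localParam_rotational hr hrm u z, ← extChartAt_rotational z] at h6
  have h7 := mfderiv_eq_fderiv_localParam hsm z
  rw [← h7] at h6
  exact h6

end Final

end Wintgen

/-! ### The theorem -/

theorem proposition3p3 {r m p : ℕ} (hr : 2 ≤ r) (hrm : r < m)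
    {M : Type*} [TopologicalSpace M] [ChartedSpace (EuclideanSpace ℝ (Fin r)) M]
    [IsManifold (𝓡 r) ∞ M]
    (u : M → EuclideanSpace ℝ (Fin (r + p)))
    (hu : Wintgen.IsSmoothImmersion (𝓡 r) u)
    (hpos : ∀ x, u x ∈ Wintgen.upperHalfSpace (r + p) (by omega)) :
    Wintgen.IsWintgenIdeal ((𝓡 r).prod (𝓡 (m - r))) (Wintgen.euclideanMetric (m + p)) 0 m p
        (Wintgen.rotational (by omega) hrm u :
          M × Metric.sphere (0 : EuclideanSpace ℝ (Fin (m - r + 1))) 1 →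
            EuclideanSpace ℝ (Fin (m + p))) ↔
      Wintgen.IsMinimal (𝓡 r) (Wintgen.hyperbolicMetric (r + p) (by omega)) r u ∧
        Wintgen.IsWintgenIdeal (𝓡 r) (Wintgen.hyperbolicMetric (r + p) (by omega)) (-1) r p u := by
  have hrp : 0 < r + p := by omega
  -- The equivalence is pointwise, and its right side depends only on the component of `z` in `M`.
  have key : ∀ z : M × Metric.sphere (0 : EuclideanSpace ℝ (Fin (m - r + 1))) 1,
      Wintgen.DDVVEquality (Wintgen.euclideanMetric (m + p)) 0 m p
        (Wintgen.localParam ((𝓡 r).prod (𝓡 (m - r))) (Wintgen.rotational hrp hrm u) z)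
        (extChartAt ((𝓡 r).prod (𝓡 (m - r))) z z) ↔
      Wintgen.MeanCurvatureVanishes (Wintgen.hyperbolicMetric (r + p) hrp) r
        (Wintgen.localParam (𝓡 r) u z.1) (extChartAt (𝓡 r) z.1 z.1) ∧
      Wintgen.DDVVEquality (Wintgen.hyperbolicMetric (r + p) hrp) (-1) r p
        (Wintgen.localParam (𝓡 r) u z.1) (extChartAt (𝓡 r) z.1 z.1) := by
    intro z
    obtain ⟨W₁, W₂, h1, h2, h3, h4, h5⟩ :=
      Wintgen.exists_local_immersions (m := m) hrp u hu hpos z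
    rw [Wintgen.localParam_rotational, Wintgen.extChartAt_rotational,
      Wintgen.hyperbolicMetric_eq]
    exact Wintgen.ddvvEquality_rotMap_iff (k := m - r)
      (Wintgen.isRotationalSplitting_padLeft hrp hrm) h5 h3 h4 h1 h2 hr (by omega) (by omega)
      (by simp) (by simp) (by simp) (by simp)
  have hf := Wintgen.isSmoothImmersion_rotational hrp hrm u hu hpos
  constructor
  · rintro ⟨-, h⟩
    -- A point of the sphere is needed to recover the conditions on `u` at each point of `M`.
    obtain ⟨w⟩ : Nonempty (Metric.sphere (0 : EuclideanSpace ℝ (Fin (m - r + 1))) 1) :=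
      (NormedSpace.sphere_nonempty.2 zero_le_one).to_subtype
    exact ⟨⟨hu, fun x => ((key (x, w)).1 (h (x, w))).1⟩,
      ⟨hu, fun x => ((key (x, w)).1 (h (x, w))).2⟩⟩
  · rintro ⟨⟨-, h1⟩, ⟨-, h2⟩⟩
    exact ⟨hf, fun z => (key z).2 ⟨h1 z.1, h2 z.1⟩⟩
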